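/- Let $A,B\in\mathbb{C}^{n\times n}$ and $D\in\mathbb{C}^{k\times k}$ be Hermitian. Suppose that $A-\lambda B$ is a positive semi-definite pencil, i.e. $A-\lambda_0B\succeq 0$ for some $\lambda_0\in\mathbb{R}$, and that $B$ is genuinely indefinite, i.e. $B$ has both positive and negative eigenvalues. Let $n_+$ and $n_-$ be the numbers of positive and of negative eigenvalues of $B$ (with multiplicity), and suppose that $k\le n_-$. A number $\mu\in\mathbb{C}$ is a finite eigenvalue of $A-\lambda B$ if $\operatorname{rank}(A-\mu B)<\rho:=\max_{z\in\mathbb{C}}\operatorname{rank}(A-zB)$; its algebraic multiplicity is the order of $\mu$ as a zero of the greatest common divisor of the $\rho\times\rho$ minors of $A-\lambda B$ (for a regular pencil: as a zero of $\det(A-\lambda B)$). A vector $x\neq0$ is an eigenvector for the finite eigenvalue $\mu$ if $Ax=\mu Bx$ and $x\notin\mathcal N(A)\cap\mathcal N(B)$. The finite eigenvalues of $A-\lambda B$, which are real and of which there are $n_++n_-$ counted with algebraic multiplicity, are labelled so that $$\lambda_{n_-}^-\le\cdots\le\lambda_1^-\le\lambda_1^+\le\cdots\le\lambda_{n_+}^+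 .$$ Let $Q^{\mathrm H}DQ=\operatorname{diag}(\omega_1,\dots,\omega_k)$ with $Q$ unitary and $\omega_1\ge\cdots\ge\omega_k$. The pencil $A-\lambda B$ is called diagonalizable if there is a nonsingular $U$ such that $U^{\mathrm H}AU$ and $U^{\mathrm H}BU$ are both diagonal. 1. If $A$ is not a real multiple of $B$ (so, in particular, $A\ne0$), then $$\inf_{X^{\mathrm H}BX=-I_k}\operatorname{tr}(DX^{\mathrm H}AX)>-\infty\quad\text{if and only if}\quad D\succeq0 .$$ 2. If $D\succeq 0$, then $$\inf_{X^{\mathrm H}BX=-I_k}\operatorname{tr}(DX^{\mathrm H}AX)=-\sum_{i=1}^k\omega_i\lambda_i^- .$$ 3. If $D\succeq 0$ and $A-\lambda B$ is diagonalizable, then the infimum is attained: there is an $X\in\mathbb{C}^{n\times k}$ with $X^{\mathrm H}BX=-I_k$ such that, for $1\le i\le k$, the $i$-th column of $XQ$ is an eigenvector of $A-\lambda B$ for the eigenvalue $\lambda_i^-$, and every such $X$ satisfies $\operatorname{tr}(DX^{\mathrm H}AX)=-\sum_{i=1}^k\omega_i\lambda_i^-$. -/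

import Mathlib

open Matrix Polynomial
open scoped ComplexOrder

noncomputable section

namespace TraceMin

variable {n k : ℕ}

/-- `A - z B` is a positive semi-definite matrix pencil: `A` and `B` are Hermitian and there is a
real `t` such that the matrix `A - t B` is positive semi-definite. -/
def IsPosSemidefPencil (A B : Matrix (Fin n) (Fin n) ℂ) : Prop :=
  A.IsHermitian ∧ B.IsHermitian ∧ ∃ t : ℝ, (A - (t : ℂ) • B).PosSemidef

/-- The number `n₋` of negative eigenvalues of a Hermitian matrix, with multiplicity. -/
def negInertia {B : Matrix (Fin n) (Fin n) ℂ} (hB : B.IsHermitian) : ℕ :=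
  (Finset.univ.filter fun i => hB.eigenvalues i < 0).card

/-- A Hermitian matrix is genuinely indefinite if it has both positive and negative eigenvalues. -/
def IsGenuinelyIndefinite {B : Matrix (Fin n) (Fin n) ℂ} (hB : B.IsHermitian) : Prop :=
  (∃ i, 0 < hB.eigenvalues i) ∧ ∃ i, hB.eigenvalues i < 0

/-- `max_{z ∈ ℂ} rank (A - z B)`. -/
def normalRank (A B : Matrix (Fin n) (Fin n) ℂ) : ℕ :=
  ⨆ z : ℂ, (A - z • B).rank

/-- `μ` is a finite eigenvalue of the pencil `A - z B`, which may be a singular pencil: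
the rank of `A - z B` drops at `z = μ`. -/
def IsFiniteEigenvalue (A B : Matrix (Fin n) (Fin n) ℂ) (μ : ℂ) : Prop :=
  (A - μ • B).rank < normalRank A B

/-- `x` is an eigenvector of the pencil `A - z B` for its finite eigenvalue `μ`. -/
def IsEigenvector (A B : Matrix (Fin n) (Fin n) ℂ) (μ : ℂ) (x : Fin n → ℂ) : Prop :=
  IsFiniteEigenvalue A B μ ∧ x ≠ 0 ∧ ¬(A *ᵥ x = 0 ∧ B *ᵥ x = 0) ∧ A *ᵥ x = μ • (B *ᵥ x)

/-- `A - X B` as a matrix of polynomials. -/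
def pencilMatrix (A B : Matrix (Fin n) (Fin n) ℂ) : Matrix (Fin n) (Fin n) ℂ[X] :=
  A.map C - (X : ℂ[X]) • B.map C

/-- The ideal of `ℂ[X]` generated by the minors of `A - X B` of the largest size for which not all
minors vanish identically. -/
def maximalMinorIdeal (A B : Matrix (Fin n) (Fin n) ℂ) : Ideal ℂ[X] :=
  Ideal.span (Set.range fun p : (Fin (normalRank A B) → Fin n) × (Fin (normalRank A B) → Fin n) =>
    ((pencilMatrix A B).submatrix p.1 p.2).det)

/-- The finite eigenvalues of the pencil `A - z B`, each repeated according to its algebraic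
multiplicity: the roots of the greatest common divisor of the maximal minors, i.e. of the product
of the invariant polynomials of `A - X B`. (For a regular pencil: the roots of `det (A - X B)`.) -/
def finiteEigenvalues (A B : Matrix (Fin n) (Fin n) ℂ) : Multiset ℂ :=
  (Submodule.IsPrincipal.generator (maximalMinorIdeal A B)).roots

/-- The finite eigenvalues (which are real for a positive semi-definite pencil) as a list of real
numbers in ascending order, repeated according to algebraic multiplicity. -/
def sortedEigenvalues (A B : Matrix (Fin n) (Fin n) ℂ) : List ℝ :=
  ((finiteEigenvalues A B).map Complex.re).sort (· ≤ ·)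

/-- `λ_i⁻`, for `1 ≤ i ≤ n₋`: the finite eigenvalues of a positive semi-definite pencil are
labelled so that `λ_{n₋}⁻ ≤ ⋯ ≤ λ_1⁻ ≤ λ_1⁺ ≤ ⋯ ≤ λ_{n₊}⁺`, so `λ_i⁻` is the entry of the ascending
list that has exactly `n₋ - i` entries before it. -/
def lambdaMinus (A : Matrix (Fin n) (Fin n) ℂ) {B : Matrix (Fin n) (Fin n) ℂ}
    (hB : B.IsHermitian) (i : ℕ) : ℝ :=
  (sortedEigenvalues A B).getD (negInertia hB - i) 0

/-- The pencil `A - z B` with Hermitian `A`, `B` is diagonalizable: some nonsingular congruence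
makes both `A` and `B` diagonal. -/
def IsDiagonalizablePencil (A B : Matrix (Fin n) (Fin n) ℂ) : Prop :=
  ∃ U : Matrix (Fin n) (Fin n) ℂ, IsUnit U ∧ (Uᴴ * A * U).IsDiag ∧ (Uᴴ * B * U).IsDiag

/-- The value `tr (D Xᴴ A X)`, which is real for Hermitian `A` and `D`
(see `traceObjective_eq_trace`). -/
def traceObjective (A : Matrix (Fin n) (Fin n) ℂ) (D : Matrix (Fin k) (Fin k) ℂ)
    (X : Matrix (Fin n) (Fin k) ℂ) : ℝ :=
  (D * Xᴴ * A * X).trace.re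

/-- The set of all values `tr (D Xᴴ A X)` under the constraint `Xᴴ B X = -I_k`. -/
def negValues (A B : Matrix (Fin n) (Fin n) ℂ) (D : Matrix (Fin k) (Fin k) ℂ) : Set ℝ :=
  {v | ∃ X : Matrix (Fin n) (Fin k) ℂ, Xᴴ * B * X = -1 ∧ traceObjective A D X = v}

theorem traceObjective_eq_trace {A : Matrix (Fin n) (Fin n) ℂ} {D : Matrix (Fin k) (Fin k) ℂ}
    (hA : A.IsHermitian) (hD : D.IsHermitian) (X : Matrix (Fin n) (Fin k) ℂ) :
    (traceObjective A D X : ℂ) = (D * Xᴴ * A * X).trace := by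
  have h : star (D * Xᴴ * A * X).trace = (D * Xᴴ * A * X).trace := by
    rw [← Matrix.trace_conjTranspose]
    simp only [Matrix.conjTranspose_mul, Matrix.conjTranspose_conjTranspose, hA.eq, hD.eq]
    rw [← Matrix.mul_assoc, ← Matrix.mul_assoc, Matrix.trace_mul_comm]
    simp only [Matrix.mul_assoc]
  exact Complex.conj_eq_iff_re.mp h

theorem rank_le_normalRank (A B : Matrix (Fin n) (Fin n) ℂ) (z : ℂ) :
    (A - z • B).rank ≤ normalRank A B :=
  le_ciSup (f := fun z : ℂ => (A - z • B).rank)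
    ⟨n, by rintro _ ⟨w, rfl⟩; exact Matrix.rank_le_width _⟩ z

theorem exists_rank_eq_normalRank (A B : Matrix (Fin n) (Fin n) ℂ) :
    ∃ z : ℂ, (A - z • B).rank = normalRank A B :=
  Nat.sSup_mem (s := Set.range fun z : ℂ => (A - z • B).rank) (Set.range_nonempty _)
    ⟨n, by rintro _ ⟨w, rfl⟩; exact Matrix.rank_le_width _⟩

theorem exists_rows {l m : ℕ} (M : Matrix (Fin l) (Fin m) ℂ) {r : ℕ} (hr : M.rank = r) :
    ∃ f : Fin r → Fin l, LinearIndependent ℂ (M.submatrix f id).row := by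
  subst hr
  rw [Matrix.rank_eq_finrank_span_row]
  obtain ⟨v, hv, -, hli⟩ := Submodule.exists_fun_fin_finrank_span_eq ℂ (Set.range M.row)
  choose f hf using hv
  refine ⟨f, ?_⟩
  have h : (M.submatrix f id).row = v := funext hf
  rw [h]
  exact hli

/-- A matrix of rank at most `r` has rank less than `r` iff all its `r × r` minors vanish. -/
theorem rank_lt_iff_minors (M : Matrix (Fin n) (Fin n) ℂ) {r : ℕ} (hr : M.rank ≤ r) :
    M.rank < r ↔ ∀ f g : Fin r → Fin n, (M.submatrix f g).det = 0 := by
  constructor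
  · intro h f g
    by_contra hdet
    have h1 := Matrix.rank_of_det_ne_zero hdet
    have h2 := Matrix.rank_submatrix_le M f g
    simp at h1
    omega
  · intro h
    by_contra hlt
    have hr' : M.rank = r := by omega
    obtain ⟨f, hf⟩ := exists_rows M hr'
    have h1 := LinearIndependent.rank_matrix hf
    obtain ⟨g, hg⟩ := exists_rows (M.submatrix f id)ᵀ (r := r)
      (by rw [Matrix.rank_transpose, h1, Fintype.card_fin])
    have h2 : IsUnit ((M.submatrix f id)ᵀ.submatrix g id) :=
      Matrix.linearIndependent_rows_iff_isUnit.mp hg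
    have h3 := (Matrix.isUnit_iff_isUnit_det _).mp h2
    apply h3.ne_zero
    rw [← h f g, ← Matrix.det_transpose (M.submatrix f g)]
    rfl

theorem eval_minor (A B : Matrix (Fin n) (Fin n) ℂ) (z : ℂ) {r : ℕ} (f g : Fin r → Fin n) :
    (((pencilMatrix A B).submatrix f g).det).eval z = ((A - z • B).submatrix f g).det := by
  rw [← Polynomial.coe_evalRingHom, RingHom.map_det]
  congr 1
  ext i j
  simp [pencilMatrix]
  ring

/-- The members of the multiset `finiteEigenvalues A B` are exactly the finite eigenvalues. -/
theorem mem_finiteEigenvalues (A B : Matrix (Fin n) (Fin n) ℂ) (μ : ℂ) :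
    μ ∈ finiteEigenvalues A B ↔ IsFiniteEigenvalue A B μ := by
  have key : ∀ z : ℂ, IsFiniteEigenvalue A B z ↔ ∀ p ∈ maximalMinorIdeal A B, p.eval z = 0 := by
    intro z
    rw [IsFiniteEigenvalue, rank_lt_iff_minors _ (rank_le_normalRank A B z)]
    constructor
    · intro h p hp
      have hle : maximalMinorIdeal A B ≤ RingHom.ker (Polynomial.evalRingHom z) := by
        refine Ideal.span_le.mpr ?_
        rintro _ ⟨q, rfl⟩
        simp only [SetLike.mem_coe, RingHom.mem_ker, Polynomial.coe_evalRingHom]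
        rw [eval_minor]
        exact h _ _
      exact hle hp
    · intro h f g
      rw [← eval_minor]
      exact h _ (Ideal.subset_span ⟨(f, g), rfl⟩)
  have hne : Submodule.IsPrincipal.generator (maximalMinorIdeal A B) ≠ 0 := by
    intro h0
    obtain ⟨z, hz⟩ := exists_rank_eq_normalRank A B
    have : IsFiniteEigenvalue A B z := by
      rw [key]
      intro p hp
      rw [(Submodule.IsPrincipal.eq_bot_iff_generator_eq_zero _).mpr h0] at hp
      rw [(Submodule.mem_bot _).mp hp, Polynomial.eval_zero]
    exact absurd this (by rw [IsFiniteEigenvalue, hz]; exact lt_irrefl _)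
  rw [finiteEigenvalues, Polynomial.mem_roots hne, key]
  constructor
  · intro h p hp
    obtain ⟨q, rfl⟩ := (Submodule.IsPrincipal.mem_iff_generator_dvd _).mp hp
    rw [Polynomial.eval_mul, h.eq_zero, zero_mul]
  · intro h
    exact h _ (Submodule.IsPrincipal.generator_mem _)

end TraceMin

end

/-!
Write `H = A - t B ≥ 0`. The proof brings the pair `(H, B)` to a normal form by congruence and then
works with explicit matrices.

*Normal form* (`hasNormalForm`). Vectors, or pairs of vectors, that are orthogonal to a complement
for both forms are split off one after the other. What remains indecomposable is either
one-dimensional, or a hyperbolic pair for `B` that forms a Jordan chain `H x = 0`, `H y = B x`.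
Rescaling the pair by a hyperbolic rotation turns its block into `B = diag(1, -1)` and
`H = s J`, where all entries of `J` are `1` and `s > 0` is arbitrary. So `A` and `B` are
simultaneously congruent to `diag(α) + s E` and `diag(β)`, with `E ≥ 0`, `α - t β ≥ 0`, and with
`α`, `β`, `E` independent of `s`.

*Eigenvalues.* Ideals of minors do not grow under multiplication by constant matrices
(`minorIdeal_mul_right_le`), so the finite eigenvalues can be read off the normal form, from which
the common kernel of `A` and `B` is removed. The determinant of a block of the pencil does not
depend on `s`, and the finite eigenvalues are the numbers `α i / β i` with `β i ≠ 0`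
(`finiteEigenvalues_of_normalForm`). By Sylvester's law (`negInertia_eq_card`) there are `n₋` indices
with `β i < 0`; their quotients are at most `t` and all others are at least `t`, so the numbers
`λ_i⁻` are the quotients with `β i < 0` in descending order (`exists_enumeration_lambdaMinus`).

*Lower bound.* Since `E ≥ 0`, it suffices to treat `diag(α)` and `diag(β)`. The constraint says that
the rows with `β < 0`, suitably scaled, form a matrix `Z` with `Zᴴ Z ≥ 1`, so that `Z Zᴴ` dominates
an orthogonal projection of rank `k` (`exists_projection_diag`). The diagonal of a projection has
entries in `[0, 1]` with sum `k`, which gives the bound for `D = 1`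
(`sum_initial_le_of_constraint`). Applied to the leading columns of `X Q` and combined by Abel
summation, it gives the bound for all weights `ω`.

*Upper bound.* The normalized basis vectors with `β < 0` reach the lower bound up to `s ∑ ω`, and
`s` is arbitrary (`exists_almost_optimal`). For a diagonalizable pencil there are no Jordan chains
and the basis vectors are eigenvectors (`exists_eigenvector_frame`).

*Unboundedness.* If some `ω_q < 0` and `H ≠ 0`, the `q`-th vector of a frame is moved towards a
`B`-isotropic direction on which `H` does not vanish, the other vectors being kept
(`exists_large_value`, `not_bddBelow_of_neg_weight`).
-/

noncomputable section

namespace TraceMin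

/-! ### Sesquilinear forms of Hermitian matrices -/

/-- The sesquilinear form `xᴴ M y` of a square matrix `M`. -/
def sesq {d : ℕ} (M : Matrix (Fin d) (Fin d) ℂ) (x y : Fin d → ℂ) : ℂ :=
  star x ⬝ᵥ M *ᵥ y

section Sesq

variable {d e : ℕ} {M : Matrix (Fin d) (Fin d) ℂ}

theorem sesq_add_right (x y z : Fin d → ℂ) : sesq M x (y + z) = sesq M x y + sesq M x z := by
  simp [sesq, mulVec_add, dotProduct_add]

theorem sesq_add_left (x y z : Fin d → ℂ) : sesq M (x + y) z = sesq M x z + sesq M y z := by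
  simp [sesq, add_dotProduct]

theorem sesq_smul_right (c : ℂ) (x y : Fin d → ℂ) : sesq M x (c • y) = c * sesq M x y := by
  simp [sesq, mulVec_smul]

theorem sesq_smul_left (c : ℂ) (x y : Fin d → ℂ) : sesq M (c • x) y = star c * sesq M x y := by
  simp [sesq]

theorem sesq_conj_symm (hM : M.IsHermitian) (x y : Fin d → ℂ) :
    sesq M y x = star (sesq M x y) := by
  unfold sesq
  rw [star_dotProduct, star_mulVec, hM.eq, ← dotProduct_mulVec]

theorem sesq_self_im (hM : M.IsHermitian) (x : Fin d → ℂ) :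
    sesq M x x = ((sesq M x x).re : ℂ) :=
  (Complex.conj_eq_iff_re.mp (sesq_conj_symm hM x x).symm).symm

theorem sesq_congr (C : Matrix (Fin d) (Fin e) ℂ) (x y : Fin e → ℂ) :
    sesq (Cᴴ * M * C) x y = sesq M (C *ᵥ x) (C *ᵥ y) := by
  simp only [sesq, ← mulVec_mulVec, star_mulVec, ← dotProduct_mulVec]

theorem sesq_of_mulVec_eq_zero {x : Fin d → ℂ} (h : M *ᵥ x = 0) (y : Fin d → ℂ) :
    sesq M y x = 0 := by simp [sesq, h]

theorem sesq_of_mulVec_eq_zero_left (hM : M.IsHermitian) {x : Fin d → ℂ} (h : M *ᵥ x = 0)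
    (y : Fin d → ℂ) : sesq M x y = 0 := by
  rw [sesq_conj_symm hM y x, sesq_of_mulVec_eq_zero h, star_zero]

theorem sesq_self_nonneg (hM : M.PosSemidef) (x : Fin d → ℂ) : 0 ≤ (sesq M x x).re :=
  (Complex.nonneg_iff.mp (hM.dotProduct_mulVec_nonneg x)).1

theorem mulVec_eq_zero_of_sesq_self (hM : M.PosSemidef) {x : Fin d → ℂ}
    (h : (sesq M x x).re = 0) : M *ᵥ x = 0 := by
  rw [← hM.dotProduct_mulVec_zero_iff x]
  change sesq M x x = 0
  rw [sesq_self_im hM.1, h, Complex.ofReal_zero]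

end Sesq

/-- The range of a Hermitian matrix contains every vector orthogonal to its kernel. -/
theorem exists_mulVec_eq_of_orthogonal_ker {d : ℕ} {H : Matrix (Fin d) (Fin d) ℂ}
    (hH : H.IsHermitian) (w : Fin d → ℂ) (hw : ∀ z, H *ᵥ z = 0 → star z ⬝ᵥ w = 0) :
    ∃ y, H *ᵥ y = w := by
  have hs := isSymmetric_toEuclideanLin_iff.mpr hH
  have h1 : WithLp.toLp 2 w ∈ (toEuclideanLin H).range := by
    rw [← Submodule.orthogonal_orthogonal (toEuclideanLin H).range, hs.orthogonal_range,
      Submodule.mem_orthogonal]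
    intro u hu
    have h2 := hw u.ofLp (by
      have := congrArg WithLp.ofLp (LinearMap.mem_ker.mp hu)
      simpa using this)
    rw [EuclideanSpace.inner_eq_star_dotProduct, dotProduct_comm]
    exact h2
  obtain ⟨y, hy⟩ := h1
  refine ⟨y.ofLp, ?_⟩
  have := congrArg WithLp.ofLp hy
  simpa using this

/-! ### A normal form for a positive semi-definite and a Hermitian matrix -/

section NormalForm

variable {ι κ : Type} [DecidableEq ι] [DecidableEq κ]

/-- The first matrix of the normal form: a real diagonal matrix `a` together with, for each
`j : κ`, a block `s J + t diag(1, -1)` where all four entries of `J` are `1`. The two basis vectors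
of the `j`-th block are indexed by the two copies of `j` in `κ ⊕ κ`. -/
def normA (a : ι → ℝ) (t s : ℝ) : Matrix (ι ⊕ (κ ⊕ κ)) (ι ⊕ (κ ⊕ κ)) ℂ :=
  fromBlocks (diagonal fun i => (a i : ℂ)) 0 0
    (fromBlocks (diagonal fun _ => ((s + t : ℝ) : ℂ)) (diagonal fun _ => (s : ℂ))
      (diagonal fun _ => (s : ℂ)) (diagonal fun _ => ((s - t : ℝ) : ℂ)))

/-- The second matrix of the normal form: a real diagonal matrix `b` together with a block
`diag(1, -1)` for each `j : κ`. -/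
def normB (b : ι → ℝ) : Matrix (ι ⊕ (κ ⊕ κ)) (ι ⊕ (κ ⊕ κ)) ℂ :=
  fromBlocks (diagonal fun i => (b i : ℂ)) 0 0
    (fromBlocks (diagonal fun _ => (1 : ℂ)) 0 0 (diagonal fun _ => (-1 : ℂ)))

end NormalForm

/-- `H` and `B` have, for every `s > 0`, a common spanning family of vectors with Gram matrices
`normA h 0 s` and `normB b`, where `h ≥ 0` and `b` do not depend on `s`. -/
def HasNormalForm {d : ℕ} (H B : Matrix (Fin d) (Fin d) ℂ) : Prop :=
  ∃ (ι κ : Type) (_ : Fintype ι) (_ : DecidableEq ι) (_ : Fintype κ) (_ : DecidableEq κ)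
    (h b : ι → ℝ), (∀ i, 0 ≤ h i) ∧ ∀ s : ℝ, 0 < s → ∃ w : ι ⊕ (κ ⊕ κ) → Fin d → ℂ,
      (⊤ ≤ Submodule.span ℂ (Set.range w)) ∧
      (∀ i j, sesq H (w i) (w j) = normA (κ := κ) h 0 s i j) ∧
      (∀ i j, sesq B (w i) (w j) = normB (κ := κ) b i j)

/-- A matrix maps everything into a span as soon as it maps a spanning family into it. -/
theorem mulVec_mem_span_of_forall_mem_range {d e : ℕ} {σ τ : Type} (C : Matrix (Fin d) (Fin e) ℂ) (w : σ → Fin e → ℂ)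
    (hw : ⊤ ≤ Submodule.span ℂ (Set.range w)) (u : τ → Fin d → ℂ)
    (hu : ∀ i, C *ᵥ w i ∈ Set.range u) (v : Fin e → ℂ) :
    C *ᵥ v ∈ Submodule.span ℂ (Set.range u) := by
  have hv : v ∈ Submodule.span ℂ (Set.range w) := hw trivial
  induction hv using Submodule.span_induction with
  | mem x hx =>
    obtain ⟨i, rfl⟩ := hx
    exact Submodule.subset_span (hu i)
  | zero => simp
  | add x y _ _ hx hy => rw [mulVec_add]; exact Submodule.add_mem _ hx hy
  | smul c x _ hx => rw [mulVec_smul]; exact Submodule.smul_mem _ c hx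

/-- Splitting off a vector that is orthogonal for both forms to a complementary subspace. -/
theorem HasNormalForm.of_split_one {d e : ℕ} {H B : Matrix (Fin d) (Fin d) ℂ}
    (hH : H.PosSemidef) (hB : B.IsHermitian) (C : Matrix (Fin d) (Fin e) ℂ) (x : Fin d → ℂ)
    (hspan : ∀ v, ∃ (a : ℂ) (u : Fin e → ℂ), v = a • x + C *ᵥ u)
    (hHx : ∀ u, sesq H x (C *ᵥ u) = 0) (hBx : ∀ u, sesq B x (C *ᵥ u) = 0)
    (hC : HasNormalForm (Cᴴ * H * C) (Cᴴ * B * C)) : HasNormalForm H B := by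
  have hHx' : ∀ u, sesq H (C *ᵥ u) x = 0 := fun u => by
    rw [sesq_conj_symm hH.1 x, hHx, star_zero]
  have hBx' : ∀ u, sesq B (C *ᵥ u) x = 0 := fun u => by
    rw [sesq_conj_symm hB x, hBx, star_zero]
  obtain ⟨ι, κ, i1, i2, i3, i4, h, b, hh, hw⟩ := hC
  refine ⟨Option ι, κ, inferInstance, inferInstance, i3, i4,
    fun o => o.elim (sesq H x x).re h, fun o => o.elim (sesq B x x).re b, ?_, ?_⟩
  · rintro (_ | i)
    · exact sesq_self_nonneg hH x
    · exact hh i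
  intro s hs
  obtain ⟨w, hsp, hwH, hwB⟩ := hw s hs
  simp only [sesq_congr] at hwH hwB
  refine ⟨Sum.elim (fun o : Option ι => o.elim x fun i => C *ᵥ w (Sum.inl i)) fun k => C *ᵥ w (Sum.inr k),
    ?_, ?_, ?_⟩
  · intro v _
    obtain ⟨a, u, rfl⟩ := hspan v
    refine Submodule.add_mem _ (Submodule.smul_mem _ _ (Submodule.subset_span ⟨Sum.inl none, rfl⟩))
      (mulVec_mem_span_of_forall_mem_range C w hsp _ ?_ u)
    rintro (i | k)
    · exact ⟨Sum.inl (some i), rfl⟩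
    · exact ⟨Sum.inr k, rfl⟩
  · rintro ((_ | i) | i) ((_ | j) | j)
    · simpa [normA] using sesq_self_im hH.1 x
    all_goals simp [normA, hHx, hHx', hwH, diagonal_apply]
  · rintro ((_ | i) | i) ((_ | j) | j)
    · simpa [normB] using sesq_self_im hB x
    all_goals simp [normB, hBx, hBx', hwB, diagonal_apply]

/-- Splitting off a pair `x`, `y` with `H x = 0` and `H y = B x` on which `B` is hyperbolic, that is,
a Jordan chain of length two. The vectors `±a x + b y` with `2 a b c = 1` and `b² c = s` have the
Gram matrices of one block of the normal form. -/
theorem HasNormalForm.of_split_two {d e : ℕ} {H B : Matrix (Fin d) (Fin d) ℂ}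
    (hH : H.PosSemidef) (hB : B.IsHermitian) (C : Matrix (Fin d) (Fin e) ℂ) (x y : Fin d → ℂ)
    (c : ℝ) (hc : 0 < c) (hxx : sesq B x x = 0) (hyy : sesq B y y = 0) (hxy : sesq B x y = c)
    (hx : H *ᵥ x = 0) (hHyy : sesq H y y = c)
    (hspan : ∀ v, ∃ (a b : ℂ) (u : Fin e → ℂ), v = a • x + b • y + C *ᵥ u)
    (hHy : ∀ u, sesq H y (C *ᵥ u) = 0) (hBx : ∀ u, sesq B x (C *ᵥ u) = 0)
    (hBy : ∀ u, sesq B y (C *ᵥ u) = 0)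
    (hC : HasNormalForm (Cᴴ * H * C) (Cᴴ * B * C)) : HasNormalForm H B := by
  have hHx : ∀ v, sesq H x v = 0 := sesq_of_mulVec_eq_zero_left hH.1 hx
  have hHx' : ∀ v, sesq H v x = 0 := sesq_of_mulVec_eq_zero hx
  have hHy' : ∀ u, sesq H (C *ᵥ u) y = 0 := fun u => by
    rw [sesq_conj_symm hH.1 y, hHy, star_zero]
  have hBx' : ∀ u, sesq B (C *ᵥ u) x = 0 := fun u => by
    rw [sesq_conj_symm hB x, hBx, star_zero]
  have hBy' : ∀ u, sesq B (C *ᵥ u) y = 0 := fun u => by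
    rw [sesq_conj_symm hB y, hBy, star_zero]
  have hyx : sesq B y x = c := by
    rw [sesq_conj_symm hB x, hxy]; simp
  obtain ⟨ι, κ, i1, i2, i3, i4, h, b, hh, hw⟩ := hC
  refine ⟨ι, Option κ, i1, i2, inferInstance, inferInstance, h, b, hh, ?_⟩
  intro s hs
  obtain ⟨w, hsp, hwH, hwB⟩ := hw s hs
  simp only [sesq_congr] at hwH hwB
  obtain ⟨β, hβ, hβs⟩ : ∃ β : ℝ, 0 < β ∧ β * β * c = s :=
    ⟨√(s / c), Real.sqrt_pos.mpr (div_pos hs hc), by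
      rw [Real.mul_self_sqrt (div_pos hs hc).le]; field_simp⟩
  obtain ⟨α, hα⟩ : ∃ α : ℝ, α * β * c = 1 / 2 := ⟨1 / (2 * β * c), by field_simp⟩
  have hβs' : (β : ℂ) * (β * c) = s := by rw [← hβs]; push_cast; ring
  have hα' : (α : ℂ) * (β * c) = 1 / 2 := by
    have : ((α * β * c : ℝ) : ℂ) = ((1 / 2 : ℝ) : ℂ) := by rw [hα]
    push_cast at this
    rw [← this]; ring
  have hα'' : (β : ℂ) * (α * c) = 1 / 2 := by rw [← hα']; ring
  have hβ0 : (β : ℂ) ≠ 0 := by exact_mod_cast hβ.ne'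
  have hα0 : (α : ℂ) ≠ 0 := by
    intro h0
    rw [h0] at hα'
    norm_num at hα'
  set p : Fin d → ℂ := (α : ℂ) • x + (β : ℂ) • y with hp
  set m : Fin d → ℂ := (-α : ℂ) • x + (β : ℂ) • y with hm
  refine ⟨Sum.elim (fun i => C *ᵥ w (Sum.inl i)) (Sum.elim
    (fun o : Option κ => o.elim p fun k => C *ᵥ w (Sum.inr (Sum.inl k)))
    (fun o : Option κ => o.elim m fun k => C *ᵥ w (Sum.inr (Sum.inr k)))), ?_, ?_, ?_⟩
  · set S := Submodule.span ℂ (Set.range (Sum.elim (fun i => C *ᵥ w (Sum.inl i)) (Sum.elim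
      (fun o : Option κ => o.elim p fun k => C *ᵥ w (Sum.inr (Sum.inl k)))
      (fun o : Option κ => o.elim m fun k => C *ᵥ w (Sum.inr (Sum.inr k)))))) with hS
    have hpS : p ∈ S := Submodule.subset_span ⟨Sum.inr (Sum.inl none), rfl⟩
    have hmS : m ∈ S := Submodule.subset_span ⟨Sum.inr (Sum.inr none), rfl⟩
    have hxS : x ∈ S := by
      have : x = (1 / (2 * α) : ℂ) • (p - m) := by
        rw [hp, hm]
        ext i
        simp
        field_simp
        ring
      rw [this]
      exact Submodule.smul_mem _ _ (Submodule.sub_mem _ hpS hmS)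
    have hyS : y ∈ S := by
      have : y = (1 / (2 * β) : ℂ) • (p + m) := by
        rw [hp, hm]
        ext i
        simp
        field_simp
        ring
      rw [this]
      exact Submodule.smul_mem _ _ (Submodule.add_mem _ hpS hmS)
    intro v _
    obtain ⟨a, b, u, rfl⟩ := hspan v
    refine Submodule.add_mem _ (Submodule.add_mem _ (Submodule.smul_mem _ _ hxS)
      (Submodule.smul_mem _ _ hyS)) (mulVec_mem_span_of_forall_mem_range C w hsp _ ?_ u)
    rintro (i | k | k)
    · exact ⟨Sum.inl i, rfl⟩
    · exact ⟨Sum.inr (Sum.inl (some k)), rfl⟩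
    · exact ⟨Sum.inr (Sum.inr (some k)), rfl⟩
  · rintro (i | (_ | i) | (_ | i)) (j | (_ | j) | (_ | j)) <;>
    simp [normA, hp, hm, hwH, diagonal_apply, sesq_add_left, sesq_add_right, sesq_smul_left,
      sesq_smul_right, hHx, hHx', hHy, hHy', hHyy, hβs', -Complex.coe_smul, -neg_smul]
  · rintro (i | (_ | i) | (_ | i)) (j | (_ | j) | (_ | j)) <;>
    simp [normB, hp, hm, hwB, diagonal_apply, sesq_add_left, sesq_add_right, sesq_smul_left,
      sesq_smul_right, hBx, hBx', hBy, hBy', hxx, hyy, hxy, hyx, hα', hα'', one_apply, -Complex.coe_smul, -neg_smul]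
    all_goals norm_num

/-- A proper subspace of `ℂ^d` is the range of a matrix with fewer than `d` columns. -/
theorem exists_matrix_range_eq {d : ℕ} (V : Submodule ℂ (Fin d → ℂ)) (hV : V ≠ ⊤) :
    ∃ e < d, ∃ C : Matrix (Fin d) (Fin e) ℂ, (∀ u, C *ᵥ u ∈ V) ∧ ∀ v ∈ V, ∃ u, v = C *ᵥ u := by
  refine ⟨Module.finrank ℂ V, by simpa using Submodule.finrank_lt hV,
    Matrix.of fun i j => (Module.finBasis ℂ V j : Fin d → ℂ) i, ?_⟩
  have key : ∀ u : Fin (Module.finrank ℂ V) → ℂ,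
      (Matrix.of fun i j => (Module.finBasis ℂ V j : Fin d → ℂ) i) *ᵥ u =
        ((∑ j, u j • Module.finBasis ℂ V j : V) : Fin d → ℂ) := by
    intro u
    ext i
    simp [mulVec, dotProduct, mul_comm]
  constructor
  · intro u
    rw [key]
    exact Submodule.coe_mem _
  · intro v hv
    refine ⟨(Module.finBasis ℂ V).repr ⟨v, hv⟩, ?_⟩
    rw [key, Module.Basis.sum_repr]

/-- The linear functional `y ↦ xᴴ M y`. -/
def sesqRight {d : ℕ} (M : Matrix (Fin d) (Fin d) ℂ) (x : Fin d → ℂ) : (Fin d → ℂ) →ₗ[ℂ] ℂ where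
  toFun := sesq M x
  map_add' := sesq_add_right x
  map_smul' c y := sesq_smul_right c x y

@[simp] theorem sesqRight_apply {d : ℕ} (M : Matrix (Fin d) (Fin d) ℂ) (x y : Fin d → ℂ) :
    sesqRight M x y = sesq M x y := rfl

/-- Splitting off `x` along the kernel of a functional that does not vanish at `x`. -/
theorem HasNormalForm.of_functional {d : ℕ} {H B : Matrix (Fin d) (Fin d) ℂ}
    (hH : H.PosSemidef) (hB : B.IsHermitian) (x : Fin d → ℂ) (f : (Fin d → ℂ) →ₗ[ℂ] ℂ)
    (hfx : f x ≠ 0) (hHx : ∀ u, f u = 0 → sesq H x u = 0) (hBx : ∀ u, f u = 0 → sesq B x u = 0)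
    (ih : ∀ e < d, ∀ H' B' : Matrix (Fin e) (Fin e) ℂ, H'.PosSemidef → B'.IsHermitian →
      HasNormalForm H' B') : HasNormalForm H B := by
  obtain ⟨e, he, C, hC1, hC2⟩ := exists_matrix_range_eq (LinearMap.ker f) (by
    intro h
    exact hfx (by rw [← LinearMap.mem_ker, h]; trivial))
  refine HasNormalForm.of_split_one hH hB C x (fun v => ?_) (fun u => hHx _ (hC1 u))
    (fun u => hBx _ (hC1 u)) (ih e he _ _ (hH.conjTranspose_mul_mul_same C)
      (isHermitian_conjTranspose_mul_mul C hB))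
  obtain ⟨u, hu⟩ := hC2 (v - (f v / f x) • x) (by
    rw [LinearMap.mem_ker, map_sub, map_smul, smul_eq_mul, div_mul_cancel₀ _ hfx, sub_self])
  exact ⟨f v / f x, u, by rw [← hu]; abel⟩

/-- The normal form exists: if `H` is nonsingular, split off an eigenvector of `H⁻¹ B`; otherwise
split off a null vector of `H` if it can be chosen not `B`-isotropic or in the kernel of `B`; in the
remaining case the kernel of `H` is `B`-isotropic, `H y = B x` is solvable for `x` in this kernel,
and the Jordan chain `x`, `y` splits off. -/
theorem hasNormalForm (d : ℕ) : ∀ H B : Matrix (Fin d) (Fin d) ℂ, H.PosSemidef → B.IsHermitian →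
    HasNormalForm H B := by
  induction d using Nat.strong_induction_on with
  | _ d ih =>
  intro H B hH hB
  rcases Nat.eq_zero_or_pos d with rfl | hd
  · refine ⟨Empty, Empty, inferInstance, inferInstance, inferInstance, inferInstance,
      fun _ => 0, fun _ => 0, fun _ => le_rfl, fun s _ => ⟨fun _ => 0, ?_, ?_, ?_⟩⟩
    · intro v _
      rw [Subsingleton.elim v 0]
      exact Submodule.zero_mem _
    · rintro (i | i | i) <;> exact i.elim
    · rintro (i | i | i) <;> exact i.elim
  have : NeZero d := ⟨hd.ne'⟩
  by_cases hdet : H.det = 0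
  · obtain ⟨x, hx0, hx⟩ := exists_mulVec_eq_zero_iff.mpr hdet
    by_cases hiso : ∃ z, H *ᵥ z = 0 ∧ sesq B z z ≠ 0
    · obtain ⟨z, hz, hzB⟩ := hiso
      exact HasNormalForm.of_functional hH hB z (sesqRight B z) hzB
        (fun u _ => sesq_of_mulVec_eq_zero_left hH.1 hz u) (fun u hu => hu) ih
    push Not at hiso
    by_cases hBx : B *ᵥ x = 0
    · refine HasNormalForm.of_functional hH hB x (sesqRight 1 x) ?_
        (fun u _ => sesq_of_mulVec_eq_zero_left hH.1 hx u)
        (fun u _ => sesq_of_mulVec_eq_zero_left hB hBx u) ih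
      simpa [sesq] using hx0
    -- By polarization `B` vanishes on the kernel of `H`.
    have hpol : ∀ z, H *ᵥ z = 0 → sesq B z x = 0 := by
      intro z hz
      have h1 := hiso (z + x) (by rw [mulVec_add, hz, hx, add_zero])
      have h2 := hiso (z + Complex.I • x) (by rw [mulVec_add, mulVec_smul, hz, hx]; simp)
      simp only [sesq_add_left, sesq_add_right, sesq_smul_left, sesq_smul_right, hiso z hz,
        hiso x hx] at h1 h2
      simp only [Complex.star_def, Complex.conj_I] at h2
      have h3 : Complex.I * (sesq B z x - sesq B x z) = 0 := by linear_combination h2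
      have h4 := (mul_eq_zero.mp h3).resolve_left Complex.I_ne_zero
      linear_combination (h1 + h4) / 2
    obtain ⟨y₀, hy₀⟩ := exists_mulVec_eq_of_orthogonal_ker hH.1 (B *ᵥ x) hpol
    have hxx : sesq B x x = 0 := hiso x hx
    have hHv : ∀ v, sesq H v y₀ = sesq B v x := fun v => by simp only [sesq, hy₀]
    have hcpos : 0 < (sesq H y₀ y₀).re := by
      refine lt_of_le_of_ne (sesq_self_nonneg hH y₀) fun h => hBx ?_
      rw [← hy₀]
      exact mulVec_eq_zero_of_sesq_self hH h.symm
    set c := (sesq H y₀ y₀).re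
    have hHyy₀ : sesq H y₀ y₀ = c := sesq_self_im hH.1 y₀
    have hyx₀ : sesq B y₀ x = c := by rw [← hHv, hHyy₀]
    have hxy₀ : sesq B x y₀ = c := by rw [sesq_conj_symm hB y₀, hyx₀]; simp
    have hc0 : (c : ℂ) ≠ 0 := by exact_mod_cast hcpos.ne'
    -- Make `y` isotropic for `B` by adding a multiple of `x`.
    set r : ℝ := -(sesq B y₀ y₀).re / (2 * c) with hr
    set y := y₀ + (r : ℂ) • x with hy
    have hHy : H *ᵥ y = B *ᵥ x := by rw [hy, mulVec_add, mulVec_smul, hx, hy₀]; simp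
    have hyy : sesq B y y = 0 := by
      simp only [hy, sesq_add_left, sesq_add_right, sesq_smul_left, sesq_smul_right, hxx, hyx₀,
        hxy₀]
      rw [sesq_self_im hB y₀, hr]
      simp
      field_simp
      ring
    have hxy : sesq B x y = c := by rw [hy, sesq_add_right, sesq_smul_right, hxx, hxy₀, mul_zero, add_zero]
    have hyx : sesq B y x = c := by rw [sesq_conj_symm hB x, hxy]; simp
    have hHvy : ∀ v, sesq H v y = sesq B v x := fun v => by simp only [sesq, hHy]
    obtain ⟨e, he, C, hC1, hC2⟩ := exists_matrix_range_eq
      (LinearMap.ker (sesqRight B x) ⊓ LinearMap.ker (sesqRight B y)) (by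
        intro h
        have : y ∈ LinearMap.ker (sesqRight B x) ⊓ LinearMap.ker (sesqRight B y) := by
          rw [h]; trivial
        exact hc0 (by rw [← hxy]; exact this.1))
    refine HasNormalForm.of_split_two hH hB C x y c hcpos hxx hyy hxy hx (by rw [hHvy, hyx])
      (fun v => ?_) (fun u => ?_) (fun u => (hC1 u).1) (fun u => (hC1 u).2)
      (ih e he _ _ (hH.conjTranspose_mul_mul_same C) (isHermitian_conjTranspose_mul_mul C hB))
    · obtain ⟨u, hu⟩ := hC2 (v - ((sesq B y v / c) • x + (sesq B x v / c) • y)) (by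
        constructor <;>
        · rw [SetLike.mem_coe, LinearMap.mem_ker, map_sub, map_add, map_smul, map_smul]
          simp [hxx, hxy, hyx, hyy, hc0])
      exact ⟨_, _, u, by rw [← hu]; abel⟩
    · rw [sesq_conj_symm hH.1 (C *ᵥ u), hHvy, sesq_conj_symm hB x]
      have : sesq B x (C *ᵥ u) = 0 := (hC1 u).1
      rw [this]; simp
  · obtain ⟨μ, hμ⟩ := Module.End.exists_eigenvalue (Matrix.toLin' (H⁻¹ * B))
    obtain ⟨x, hx, hx0⟩ := hμ.exists_hasEigenvector
    rw [Module.End.mem_eigenspace_iff, toLin'_apply] at hx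
    have hHB : B *ᵥ x = μ • H *ᵥ x := by
      rw [← mulVec_smul, ← hx, mulVec_mulVec, Matrix.mul_nonsing_inv_cancel_left _ _
        (Ne.isUnit hdet)]
    have hxH : sesq H x x ≠ 0 := by
      intro h
      have h1 := mulVec_eq_zero_of_sesq_self hH (x := x) (by rw [h]; rfl)
      exact hdet (exists_mulVec_eq_zero_iff.mp ⟨x, hx0, h1⟩)
    refine HasNormalForm.of_functional hH hB x (sesqRight H x) hxH (fun u hu => hu)
      (fun u hu => ?_) ih
    rw [sesqRight_apply] at hu
    rw [sesq_conj_symm hB u]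
    have : sesq B u x = μ * sesq H u x := by
      simp only [sesq, hHB, dotProduct_smul, smul_eq_mul]
    rw [this, sesq_conj_symm hH.1 x, hu]
    simp

/-! ### Ideals of minors and finite eigenvalues of congruent pencils -/

section MinorIdeal

variable {R : Type*} [CommRing R] {l m o : Type*}

/-- The ideal generated by the minors of size `r` of a matrix. Rows and columns may be repeated,
which only adds vanishing minors and changes of sign. -/
def minorIdeal (P : Matrix l m R) (r : ℕ) : Ideal R :=
  Ideal.span (Set.range fun p : (Fin r → l) × (Fin r → m) => (P.submatrix p.1 p.2).det)

theorem minorIdeal_transpose (P : Matrix l m R) (r : ℕ) : minorIdeal Pᵀ r = minorIdeal P r := by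
  unfold minorIdeal
  congr 1
  ext x
  constructor
  · rintro ⟨⟨f, g⟩, rfl⟩
    exact ⟨(g, f), (det_transpose _).symm.trans rfl⟩
  · rintro ⟨⟨f, g⟩, rfl⟩
    exact ⟨(g, f), (det_transpose _).symm.trans rfl⟩

theorem minorIdeal_mul_right_le [Fintype m] (P : Matrix l m R) (N : Matrix m o R) (r : ℕ) :
    minorIdeal (P * N) r ≤ minorIdeal P r := by
  refine Ideal.span_le.mpr ?_
  rintro _ ⟨⟨f, g⟩, rfl⟩
  -- Expand the minor multilinearly in its columns, which are combinations of the columns of `P`.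
  have h : ((P * N).submatrix f g).det =
      ∑ s : Fin r → m, (∏ j, N (s j) (g j)) * (P.submatrix f s).det := by
    rw [← det_transpose]
    have h1 : ((P * N).submatrix f g)ᵀ = fun j => ∑ i, N i (g j) • fun a => P (f a) i := by
      ext j a
      simp [mul_apply, mul_comm]
    change detRowAlternating _ = _
    rw [h1]
    change (detRowAlternating (R := R) (n := Fin r)).toMultilinearMap _ = _
    rw [MultilinearMap.map_sum]
    refine Finset.sum_congr rfl fun s _ => ?_
    rw [MultilinearMap.map_smul_univ, smul_eq_mul, ← det_transpose (P.submatrix f s)]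
    rfl
  simp only [SetLike.mem_coe]
  rw [h]
  exact Ideal.sum_mem _ fun s _ => Ideal.mul_mem_left _ _ (Ideal.subset_span ⟨(f, s), rfl⟩)

theorem minorIdeal_mul_left_le [Fintype m] (N : Matrix l m R) (P : Matrix m o R) (r : ℕ) :
    minorIdeal (N * P) r ≤ minorIdeal P r := by
  rw [← minorIdeal_transpose, ← minorIdeal_transpose P, transpose_mul]
  exact minorIdeal_mul_right_le _ _ _

theorem minorIdeal_card {τ : Type*} [Fintype τ] [DecidableEq τ] (P : Matrix τ τ R) :
    minorIdeal P (Fintype.card τ) = Ideal.span {P.det} := by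
  let e := (Fintype.equivFin τ).symm
  apply le_antisymm
  · refine Ideal.span_le.mpr ?_
    rintro _ ⟨⟨f, g⟩, rfl⟩
    have h : P.submatrix f g = (1 : Matrix τ τ R).submatrix f e * P.submatrix e e *
        (1 : Matrix τ τ R).submatrix e g := by
      rw [submatrix_mul_equiv, one_mul, submatrix_mul_equiv, mul_one]
    simp only [SetLike.mem_coe]
    rw [h, det_mul, det_mul, det_submatrix_equiv_self]
    exact Ideal.mul_mem_right _ _ (Ideal.mul_mem_left _ _ (Ideal.mem_span_singleton_self _))
  · rw [Ideal.span_singleton_le_iff_mem]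
    exact Ideal.subset_span ⟨(e, e), det_submatrix_equiv_self e P⟩

end MinorIdeal

/-- The pencil `A - X B` with an arbitrary index type. -/
def polyPencil {τ : Type*} (A B : Matrix τ τ ℂ) : Matrix τ τ ℂ[X] :=
  A.map C - (X : ℂ[X]) • B.map C

theorem polyPencil_congr {σ τ : Type*} [Fintype σ] [Fintype τ]
    (U : Matrix σ τ ℂ) (A B : Matrix σ σ ℂ) :
    polyPencil (Uᴴ * A * U) (Uᴴ * B * U) = Uᴴ.map C * polyPencil A B * U.map C := by
  simp only [polyPencil, Matrix.map_mul, Matrix.mul_sub, Matrix.sub_mul, Matrix.mul_smul,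
    Matrix.smul_mul]

theorem eval_det_polyPencil {τ : Type*} [Fintype τ] [DecidableEq τ] (A B : Matrix τ τ ℂ) (z : ℂ) :
    (polyPencil A B).det.eval z = (A - z • B).det := by
  rw [← Polynomial.coe_evalRingHom, RingHom.map_det]
  congr 1
  ext i j
  simp [polyPencil]
  ring

/-- If the pencils `A - z B` and `G - z K` are congruent to each other through possibly rectangular
matrices and the second pencil is regular, then the finite eigenvalues of the first are the roots
of `det (G - X K)`. -/
theorem finiteEigenvalues_eq_roots {n : ℕ} {τ : Type*} [Fintype τ] [DecidableEq τ]
    {A B : Matrix (Fin n) (Fin n) ℂ} {G K : Matrix τ τ ℂ} (U : Matrix (Fin n) τ ℂ)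
    (V : Matrix τ (Fin n) ℂ) (hA : Uᴴ * A * U = G) (hB : Uᴴ * B * U = K)
    (hA' : Vᴴ * G * V = A) (hB' : Vᴴ * K * V = B) (hdet : (polyPencil G K).det ≠ 0) :
    finiteEigenvalues A B = (polyPencil G K).det.roots := by
  have hz1 : ∀ z : ℂ, Uᴴ * (A - z • B) * U = G - z • K := fun z => by
    simp [Matrix.mul_sub, Matrix.sub_mul, hA, hB]
  have hz2 : ∀ z : ℂ, Vᴴ * (G - z • K) * V = A - z • B := fun z => by
    simp [Matrix.mul_sub, Matrix.sub_mul, hA', hB']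
  have hr1 : ∀ z : ℂ, (A - z • B).rank ≤ Fintype.card τ := fun z => by
    rw [← hz2]
    exact (rank_mul_le_right _ _).trans (rank_le_card_height V)
  have hnr : normalRank A B = Fintype.card τ := by
    apply le_antisymm
    · exact ciSup_le hr1
    · obtain ⟨z, hz⟩ : ∃ z : ℂ, (polyPencil G K).det.eval z ≠ 0 := by
        by_contra! h
        exact hdet (Polynomial.funext fun z => by rw [h, eval_zero])
      rw [eval_det_polyPencil] at hz
      refine le_trans ?_ (rank_le_normalRank A B z)
      rw [← rank_of_isUnit (G - z • K) ((isUnit_iff_isUnit_det _).mpr (Ne.isUnit hz)), ← hz1]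
      exact (rank_mul_le_left _ _).trans (rank_mul_le_right _ _)
  have hideal : maximalMinorIdeal A B = Ideal.span {(polyPencil G K).det} := by
    rw [← minorIdeal_card, ← hnr]
    change minorIdeal (polyPencil A B) _ = _
    apply le_antisymm
    · rw [← hA', ← hB', polyPencil_congr]
      exact (minorIdeal_mul_right_le _ _ _).trans ((minorIdeal_mul_left_le _ _ _).trans
        (by rw [hA', hB']))
    · rw [← hA, ← hB, polyPencil_congr]
      exact (minorIdeal_mul_right_le _ _ _).trans (minorIdeal_mul_left_le _ _ _)
  have hass : Associated (Submodule.IsPrincipal.generator (maximalMinorIdeal A B))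
      (polyPencil G K).det := by
    rw [← Ideal.span_singleton_eq_span_singleton, Ideal.span_singleton_generator, hideal]
  exact hass.roots_eq

/-! ### Eigenvalues of the normal form -/

section NormalFormEigenvalues

variable {ι κ : Type} [DecidableEq ι] [DecidableEq κ]

/-- The diagonal of `normA a t 0`. -/
def diagA (a : ι → ℝ) (t : ℝ) : ι ⊕ (κ ⊕ κ) → ℝ :=
  Sum.elim a (Sum.elim (fun _ => t) fun _ => -t)

/-- The diagonal of `normB b`. -/
def diagB (b : ι → ℝ) : ι ⊕ (κ ⊕ κ) → ℝ :=
  Sum.elim b (Sum.elim (fun _ => 1) fun _ => -1)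

theorem normB_eq_diagonal (b : ι → ℝ) :
    normB (κ := κ) b = diagonal fun i => ((diagB b i : ℝ) : ℂ) := by
  ext (i | i | i) (j | j | j) <;> simp [normB, diagB, diagonal_apply, one_apply]

/-- The row operation and the column operation that subtract one half of each `2 × 2` block from
the other make the pencil triangular; its determinant does not depend on `s`. -/
theorem det_polyPencil_norm [Fintype ι] [Fintype κ] (a b : ι → ℝ) (t s : ℝ) :
    (polyPencil (normA (κ := κ) a t s) (normB b)).det =
      ∏ i : ι ⊕ (κ ⊕ κ), (C ((diagA a t i : ℝ) : ℂ) - X * C ((diagB b i : ℝ) : ℂ)) := by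
  set E : Matrix (κ ⊕ κ) (κ ⊕ κ) ℂ[X] := fromBlocks 1 (-1) 0 1 with hE
  have hEdet : E.det = 1 := by simp [hE]
  set M : Matrix (κ ⊕ κ) (κ ⊕ κ) ℂ[X] :=
    fromBlocks (diagonal fun _ => C ((s + t : ℝ) : ℂ) - X) (diagonal fun _ => C ((s : ℝ) : ℂ))
      (diagonal fun _ => C ((s : ℝ) : ℂ)) (diagonal fun _ => C ((s - t : ℝ) : ℂ) + X) with hM
  have hblock : polyPencil (normA (κ := κ) a t s) (normB b) =
      fromBlocks (diagonal fun i => C ((a i : ℝ) : ℂ) - X * C ((b i : ℝ) : ℂ)) 0 0 M := by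
    ext1 (i | i | i) (j | j | j) <;>
      simp only [polyPencil, normA, normB, hM, Matrix.sub_apply, map_apply, Matrix.smul_apply,
        fromBlocks_apply₁₁, fromBlocks_apply₁₂, fromBlocks_apply₂₁, fromBlocks_apply₂₂,
        diagonal_apply, Matrix.zero_apply] <;>
      (try split_ifs) <;> simp
  have hMdet : M.det = (∏ _i : κ, (C ((t : ℝ) : ℂ) - X)) * ∏ _i : κ, (-C ((t : ℝ) : ℂ) + X) := by
    have h1 : E * M * E = fromBlocks (diagonal fun _ => C ((t : ℝ) : ℂ) - X) 0
        (diagonal fun _ => C ((s : ℝ) : ℂ)) (diagonal fun _ => -C ((t : ℝ) : ℂ) + X) := by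
      rw [hE, hM, fromBlocks_multiply, fromBlocks_multiply]
      congr 1 <;> ext1 i j <;> by_cases hij : i = j <;> simp [hij] <;> ring
    have h2 : (E * M * E).det = M.det := by rw [det_mul, det_mul, hEdet]; ring
    rw [← h2, h1, det_fromBlocks_zero₁₂, det_diagonal, det_diagonal]
  rw [hblock, det_fromBlocks_zero₁₂, det_diagonal, hMdet, Fintype.prod_sum_type,
    Fintype.prod_sum_type]
  congr 1
  congr 1
  · simp [diagA, diagB]
  · simp [diagA, diagB]

theorem roots_linear (a b : ℂ) :
    (C a - X * C b).roots = if b = 0 then 0 else {a / b} := by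
  split_ifs with hb
  · simp [hb]
  · have : C a - X * C b = C (-b) * X + C a := by simp; ring
    rw [this, roots_C_mul_X_add_C _ (neg_ne_zero.mpr hb)]
    congr 1
    field_simp

theorem linear_ne_zero (a b : ℂ) (h : a ≠ 0 ∨ b ≠ 0) : C a - X * C b ≠ 0 := by
  intro h0
  have h1 := congrArg (fun p => coeff p 0) h0
  have h2 := congrArg (fun p => coeff p 1) h0
  simp [coeff_C] at h1 h2
  tauto

theorem congr_cancel {σ τ : Type*} [Fintype σ] [Fintype τ] [DecidableEq σ] {U : Matrix σ τ ℂ}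
    {V : Matrix τ σ ℂ} (hUV : U * V = 1) (M : Matrix σ σ ℂ) : Vᴴ * (Uᴴ * M * U) * V = M := by
  have hVU : Vᴴ * Uᴴ = 1 := by rw [← conjTranspose_mul, hUV, conjTranspose_one]
  rw [← Matrix.mul_assoc, ← Matrix.mul_assoc, hVU, Matrix.one_mul, Matrix.mul_assoc, hUV,
    Matrix.mul_one]

/-- The finite eigenvalues of a pencil congruent to a normal form are the quotients of the
diagonal entries. Indices with `a i = b i = 0` belong to the singular part of the pencil and are
removed before the determinant is taken. -/
theorem finiteEigenvalues_of_normalForm {n : ℕ} [Fintype ι] [Fintype κ]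
    {A B : Matrix (Fin n) (Fin n) ℂ} (a b : ι → ℝ) (t s : ℝ) (U : Matrix (Fin n) (ι ⊕ (κ ⊕ κ)) ℂ)
    (V : Matrix (ι ⊕ (κ ⊕ κ)) (Fin n) ℂ) (hUV : U * V = 1)
    (hA : Uᴴ * A * U = normA a t s) (hB : Uᴴ * B * U = normB b) :
    finiteEigenvalues A B = ∑ i : ι ⊕ (κ ⊕ κ),
      if diagB b i = 0 then 0 else {(((diagA a t i / diagB b i : ℝ)) : ℂ)} := by
  classical
  have hA' : Vᴴ * normA (κ := κ) a t s * V = A := by rw [← hA, congr_cancel hUV]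
  have hB' : Vᴴ * normB (κ := κ) b * V = B := by rw [← hB, congr_cancel hUV]
  let ι₀ := {i : ι // a i ≠ 0 ∨ b i ≠ 0}
  let f : ι₀ ⊕ (κ ⊕ κ) → ι ⊕ (κ ⊕ κ) := Sum.map Subtype.val id
  let J : Matrix (ι ⊕ (κ ⊕ κ)) (ι₀ ⊕ (κ ⊕ κ)) ℂ := (1 : Matrix _ _ ℂ).submatrix id f
  have hJ : ∀ M : Matrix (ι ⊕ (κ ⊕ κ)) (ι ⊕ (κ ⊕ κ)) ℂ, Jᴴ * M * J = M.submatrix f f := by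
    intro M
    ext i j
    simp [J, mul_apply, one_apply]
  have hGA : (normA a t s).submatrix f f =
      normA (κ := κ) (fun i : ι₀ => a i.1) t s := by
    ext (i | i | i) (j | j | j) <;> simp [normA, f, diagonal_apply, ι₀, Subtype.ext_iff]
  have hGB : (normB b).submatrix f f = normB (κ := κ) (fun i : ι₀ => b i.1) := by
    ext (i | i | i) (j | j | j) <;> simp [normB, f, diagonal_apply, ι₀, Subtype.ext_iff]
  have hJJ : J * Jᴴ = diagonal (Sum.elim (fun i => if a i ≠ 0 ∨ b i ≠ 0 then 1 else 0)
      (fun _ => 1)) := by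
    ext (i | i) (j | j)
    · by_cases hi : a i ≠ 0 ∨ b i ≠ 0
      · rw [mul_apply, Finset.sum_eq_single (Sum.inl ⟨i, hi⟩)]
        · simp [J, f, one_apply, diagonal_apply, hi, eq_comm]
        · rintro (p | p) _ hp
          · have : i ≠ p.1 := fun h => hp (by subst h; rfl)
            simp [J, f, one_apply, this]
          · simp [J, f, one_apply]
        · simp
      · rw [mul_apply, Finset.sum_eq_zero]
        · simp only [diagonal_apply, Sum.elim_inl, if_neg hi, ite_self]
        · rintro (p | p) _
          · have : i ≠ p.1 := fun h => hi (by rw [h]; exact p.2)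
            simp [J, f, one_apply, this]
          · simp [J, f, one_apply]
    · simp [mul_apply, J, f, one_apply]
    · simp [mul_apply, J, f, one_apply]
    · simp [mul_apply, J, f, one_apply, diagonal_apply, eq_comm]
  have hz : ∀ i, ¬(a i ≠ 0 ∨ b i ≠ 0) → a i = 0 ∧ b i = 0 := fun i h => by tauto
  have hJA : J * Jᴴ * normA (κ := κ) a t s * (J * Jᴴ) = normA a t s := by
    rw [hJJ]
    ext (i | i | i) (j | j | j) <;>
      simp only [diagonal_mul, mul_diagonal, normA, fromBlocks_apply₁₁, fromBlocks_apply₁₂,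
        fromBlocks_apply₂₁, fromBlocks_apply₂₂, Matrix.zero_apply, Sum.elim_inl, Sum.elim_inr, mul_zero,
        zero_mul, one_mul, mul_one]
    by_cases hi : a i ≠ 0 ∨ b i ≠ 0
    · by_cases hij : i = j
      · subst hij
        rw [if_pos hi, one_mul, mul_one]
      · simp [hij]
    · rw [if_neg hi]
      by_cases hij : i = j
      · simp [← hij, (hz i hi).1]
      · simp [hij]
  have hJB : J * Jᴴ * normB (κ := κ) b * (J * Jᴴ) = normB b := by
    rw [hJJ]
    ext (i | i | i) (j | j | j) <;>
      simp only [diagonal_mul, mul_diagonal, normB, fromBlocks_apply₁₁, fromBlocks_apply₁₂,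
        fromBlocks_apply₂₁, fromBlocks_apply₂₂, Matrix.zero_apply, Sum.elim_inl, Sum.elim_inr, mul_zero,
        zero_mul, one_mul, mul_one]
    by_cases hi : a i ≠ 0 ∨ b i ≠ 0
    · by_cases hij : i = j
      · subst hij
        rw [if_pos hi, one_mul, mul_one]
      · simp [hij]
    · rw [if_neg hi]
      by_cases hij : i = j
      · simp [← hij, (hz i hi).2]
      · simp [hij]
  have hne : ∀ i : ι₀ ⊕ (κ ⊕ κ), ((diagA (fun i : ι₀ => a i.1) t i : ℝ) : ℂ) ≠ 0 ∨
      ((diagB (fun i : ι₀ => b i.1) i : ℝ) : ℂ) ≠ 0 := by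
    rintro (i | i | i)
    · simpa [diagA, diagB] using i.2
    · simp [diagB]
    · simp [diagB]
  have hdet : (polyPencil (normA (κ := κ) (fun i : ι₀ => a i.1) t s)
      (normB fun i : ι₀ => b i.1)).det ≠ 0 := by
    rw [det_polyPencil_norm, Finset.prod_ne_zero_iff]
    exact fun i _ => linear_ne_zero _ _ (hne i)
  rw [finiteEigenvalues_eq_roots (U * J) (Jᴴ * V) ?_ ?_ ?_ ?_ hdet, det_polyPencil_norm,
    roots_prod _ _ (by rw [← det_polyPencil_norm (s := s)]; exact hdet)]
  · rw [Multiset.bind, Multiset.join, ← Finset.sum_eq_multiset_sum]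
    simp only [roots_linear]
    rw [Fintype.sum_sum_type, Fintype.sum_sum_type
      (f := fun i : ι ⊕ (κ ⊕ κ) => if diagB b i = 0 then (0 : Multiset ℂ) else _)]
    congr 1
    · rw [← Fintype.sum_subtype_add_sum_subtype (fun i => a i ≠ 0 ∨ b i ≠ 0)]
      rw [Finset.sum_eq_zero (s := (Finset.univ : Finset {i // ¬(a i ≠ 0 ∨ b i ≠ 0)}))
        fun i _ => by simp [diagB, (hz i.1 i.2).2], add_zero]
      simp [diagA, diagB]
      congr!
    · simp [diagA, diagB]
  · rw [← hGA, ← hJ, ← hA, conjTranspose_mul]; simp only [Matrix.mul_assoc]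
  · rw [← hGB, ← hJ, ← hB, conjTranspose_mul]; simp only [Matrix.mul_assoc]
  · rw [← hGA, ← hJ]
    refine Eq.trans ?_ ((congrArg (fun M => Vᴴ * M * V) hJA).trans hA')
    simp only [conjTranspose_mul, conjTranspose_conjTranspose, Matrix.mul_assoc]
  · rw [← hGB, ← hJ]
    refine Eq.trans ?_ ((congrArg (fun M => Vᴴ * M * V) hJB).trans hB')
    simp only [conjTranspose_mul, conjTranspose_conjTranspose, Matrix.mul_assoc]

end NormalFormEigenvalues

/-! ### Inertia -/

theorem dotProduct_diagonal_mulVec {σ : Type*} [Fintype σ] [DecidableEq σ] (x : σ → ℝ) (v : σ → ℂ) :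
    star v ⬝ᵥ (diagonal (fun i => (x i : ℂ)) *ᵥ v) =
      ((∑ i, x i * Complex.normSq (v i) : ℝ) : ℂ) := by
  simp only [dotProduct, mulVec_diagonal, Pi.star_apply, Complex.ofReal_sum, Complex.ofReal_mul,
    Complex.normSq_eq_conj_mul_self, Complex.star_def]
  exact Finset.sum_congr rfl fun i _ => by ring

/-- One half of Sylvester's law of inertia: a congruence does not increase the number of negative
entries of a diagonal matrix. -/
theorem card_neg_le_of_congr {σ τ : Type*} [Fintype σ] [DecidableEq σ] [Fintype τ] [DecidableEq τ]
    (x : σ → ℝ) (y : τ → ℝ) (T : Matrix σ τ ℂ)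
    (h : Tᴴ * diagonal (fun i => (x i : ℂ)) * T = diagonal fun i => (y i : ℂ)) :
    Fintype.card {j // y j < 0} ≤ Fintype.card {i // x i < 0} := by
  let N : Matrix {i // x i < 0} {j // y j < 0} ℂ := T.submatrix Subtype.val Subtype.val
  let T' : Matrix σ {j // y j < 0} ℂ := T.submatrix id Subtype.val
  have hT' : T'ᴴ * diagonal (fun i => (x i : ℂ)) * T' =
      diagonal fun j : {j // y j < 0} => ((y j.1 : ℝ) : ℂ) := by
    have h1 := congrArg (fun M => M.submatrix (Subtype.val : {j // y j < 0} → τ)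
      (Subtype.val : {j // y j < 0} → τ)) h
    simp only [submatrix_diagonal _ _ Subtype.val_injective] at h1
    exact h1
  have hinj : Function.Injective N.mulVecLin := by
    rw [← LinearMap.ker_eq_bot, LinearMap.ker_eq_bot']
    intro c hc
    have hc' : ∀ i : σ, x i < 0 → (T' *ᵥ c) i = 0 := fun i hi => congrFun hc ⟨i, hi⟩
    have h2 : star c ⬝ᵥ ((T'ᴴ * diagonal (fun i => (x i : ℂ)) * T') *ᵥ c) =
        star (T' *ᵥ c) ⬝ᵥ (diagonal (fun i => (x i : ℂ)) *ᵥ (T' *ᵥ c)) := by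
      simp only [← mulVec_mulVec, star_mulVec, ← dotProduct_mulVec]
    rw [hT', dotProduct_diagonal_mulVec (fun j : {j // y j < 0} => y j.1),
      dotProduct_diagonal_mulVec, Complex.ofReal_inj] at h2
    have h3 : 0 ≤ ∑ i, x i * Complex.normSq ((T' *ᵥ c) i) := by
      refine Finset.sum_nonneg fun i _ => ?_
      rcases lt_or_ge (x i) 0 with hi | hi
      · simp [hc' i hi]
      · exact mul_nonneg hi (Complex.normSq_nonneg _)
    rw [← h2] at h3
    have h4 : ∀ j : {j // y j < 0}, y j.1 * Complex.normSq (c j) ≤ 0 := fun j =>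
      mul_nonpos_of_nonpos_of_nonneg j.2.le (Complex.normSq_nonneg _)
    have h5 := (Finset.sum_eq_zero_iff_of_nonpos fun j _ => h4 j).mp
      (le_antisymm (Finset.sum_nonpos fun j _ => h4 j) h3)
    ext j
    exact Complex.normSq_eq_zero.mp
      ((mul_eq_zero.mp (h5 j (Finset.mem_univ _))).resolve_left j.2.ne)
  simpa using LinearMap.finrank_le_finrank_of_injective hinj

theorem negInertia_eq_card {n : ℕ} {σ : Type*} [Fintype σ] [DecidableEq σ]
    {B : Matrix (Fin n) (Fin n) ℂ} (hB : B.IsHermitian) (y : σ → ℝ) (U : Matrix (Fin n) σ ℂ)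
    (V : Matrix σ (Fin n) ℂ) (hUV : U * V = 1)
    (h : Uᴴ * B * U = diagonal fun i => (y i : ℂ)) :
    negInertia hB = Fintype.card {i // y i < 0} := by
  have hneg : negInertia hB = Fintype.card {i // hB.eigenvalues i < 0} := by
    rw [negInertia, Fintype.card_subtype]
  set W : Matrix (Fin n) (Fin n) ℂ := (hB.eigenvectorUnitary : Matrix (Fin n) (Fin n) ℂ)
  have hWW' : Wᴴ * W = 1 := (Matrix.mem_unitaryGroup_iff').mp hB.eigenvectorUnitary.2
  have hspec : B = W * diagonal (fun i => (hB.eigenvalues i : ℂ)) * Wᴴ := by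
    have := hB.spectral_theorem
    rw [Unitary.conjStarAlgAut_apply] at this
    exact this
  rw [hneg]
  apply le_antisymm
  · refine card_neg_le_of_congr y hB.eigenvalues (V * W) ?_
    have h1 : Wᴴ * (Vᴴ * (Uᴴ * B * U) * V) * W = Wᴴ * B * W := by rw [congr_cancel hUV]
    have h2 : Wᴴ * B * W = diagonal (fun i => (hB.eigenvalues i : ℂ)) := by
      conv_lhs => rw [hspec]
      rw [← Matrix.mul_assoc, ← Matrix.mul_assoc, hWW', Matrix.one_mul, Matrix.mul_assoc, hWW',
        Matrix.mul_one]
    rw [← h2, ← h1, h, conjTranspose_mul]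
    simp only [Matrix.mul_assoc]
  · refine card_neg_le_of_congr hB.eigenvalues y (Wᴴ * U) ?_
    have h1 : Uᴴ * (W * diagonal (fun i => (hB.eigenvalues i : ℂ)) * Wᴴ) * U = Uᴴ * B * U := by
      rw [← hspec]
    rw [← h, ← h1, conjTranspose_mul, conjTranspose_conjTranspose]
    simp only [Matrix.mul_assoc]

/-! ### The sorted list of quotients -/

/-- If `0 ≤ α - t β`, then the quotients `α i / β i` with `β i < 0` are at most `t` and those with
`β i > 0` are at least `t`, so the former come first in the ascending list of all quotients. -/
theorem exists_enumeration {σ : Type*} [Fintype σ] [DecidableEq σ] (α β : σ → ℝ) (t : ℝ)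
    (h : ∀ i, 0 ≤ α i - t * β i) (m : ℕ) (hm : m = Fintype.card {i // β i < 0}) :
    ∃ j : Fin m ≃ {i // β i < 0}, (Antitone fun p => α (j p) / β (j p)) ∧
      ∀ p : Fin m, ((∑ i, if β i = 0 then (0 : Multiset ℝ) else {α i / β i}).sort
        (· ≤ ·)).getD (m - (p + 1)) 0 = α (j p) / β (j p) := by
  let e : Fin m ≃ {i // β i < 0} := (finCongr hm).trans (Fintype.equivFin _).symm
  let f : Fin m → ℝ := fun p => α (e p) / β (e p)
  let g : Fin m → ℝ := f ∘ Tuple.sort f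
  have hg : Monotone g := Tuple.monotone_sort f
  set P : Multiset ℝ := ∑ i, if 0 < β i then {α i / β i} else 0 with hP
  have hPmem : ∀ x ∈ P, t ≤ x := by
    intro x hx
    rw [hP, Multiset.mem_sum] at hx
    obtain ⟨i, -, hi⟩ := hx
    split_ifs at hi with hb
    · rw [Multiset.mem_singleton] at hi
      rw [hi, le_div_iff₀ hb]
      linarith [h i]
    · simp at hi
  have hgt : ∀ p, g p ≤ t := by
    intro p
    have := (e (Tuple.sort f p)).2
    change α (e (Tuple.sort f p)) / β (e (Tuple.sort f p)) ≤ t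
    rw [div_le_iff_of_neg this]
    linarith [h (e (Tuple.sort f p))]
  have hM : (∑ i, if β i = 0 then (0 : Multiset ℝ) else {α i / β i}) =
      ((List.ofFn g ++ P.sort (· ≤ ·) : List ℝ) : Multiset ℝ) := by
    have h1 : ∀ i, (if β i = 0 then (0 : Multiset ℝ) else {α i / β i}) =
        (if β i < 0 then {α i / β i} else 0) + if 0 < β i then {α i / β i} else 0 := by
      intro i
      rcases lt_trichotomy (β i) 0 with hi | hi | hi
      · simp [hi, hi.ne, hi.le]
      · simp [hi]
      · simp [hi, hi.ne', hi.le]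
    rw [Finset.sum_congr rfl fun i _ => h1 i, Finset.sum_add_distrib, ← hP, ← Multiset.coe_add,
      Multiset.sort_eq]
    congr 1
    rw [← Fintype.sum_subtype_add_sum_subtype (fun i => β i < 0), Finset.sum_eq_zero
      (s := (Finset.univ : Finset {i // ¬ β i < 0})) fun i _ => by rw [if_neg i.2], add_zero,
      ← Fin.univ_val_map, ← Multiset.sum_map_singleton (Multiset.map g _),
      Multiset.map_map]
    rw [← Equiv.sum_comp ((Tuple.sort f).trans e)]
    exact Finset.sum_congr rfl fun p _ => by rw [if_pos (((Tuple.sort f).trans e) p).2]; rfl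
  have hsort : (∑ i, if β i = 0 then (0 : Multiset ℝ) else {α i / β i}).sort (· ≤ ·) =
      List.ofFn g ++ P.sort (· ≤ ·) := by
    refine List.Perm.eq_of_pairwise' (r := (· ≤ ·)) (Multiset.pairwise_sort _ _) ?_ ?_
    · rw [List.pairwise_append]
      refine ⟨List.pairwise_ofFn.mpr fun p q hpq => hg hpq.le, Multiset.pairwise_sort _ _, ?_⟩
      intro a ha b hb
      rw [List.mem_ofFn] at ha
      obtain ⟨p, rfl⟩ := ha
      exact (hgt p).trans (hPmem b (Multiset.mem_sort _ |>.mp hb))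
    · rw [← Multiset.coe_eq_coe, Multiset.sort_eq, hM]
  refine ⟨Fin.revPerm.trans ((Tuple.sort f).trans e), ?_, ?_⟩
  · intro p q hpq
    exact hg (Fin.rev_le_rev.mpr hpq)
  · intro p
    rw [hsort, List.getD_append _ _ _ _ (by rw [List.length_ofFn]; omega),
      List.getD_eq_getElem _ _ (by rw [List.length_ofFn]; omega),
      List.getElem_ofFn]
    rfl

/-! ### The lower bound for diagonal matrices -/

/-- Abel summation: weighted sums with nonnegative antitone weights inherit nonnegativity from
the partial sums. -/
theorem sum_mul_nonneg_of_partialSums : ∀ (k : ℕ) (ω d : Fin k → ℝ), Antitone ω → (∀ i, 0 ≤ ω i) →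
    (∀ r (hr : r ≤ k), 0 ≤ ∑ q : Fin r, d (Fin.castLE hr q)) → 0 ≤ ∑ q, ω q * d q := by
  intro k
  induction k with
  | zero => intros; simp
  | succ k ih =>
    intro ω d hω h0 hd
    have h1 := ih (fun q => ω q.castSucc - ω (Fin.last k)) (fun q => d q.castSucc)
      (fun p q hpq => sub_le_sub_right (hω (Fin.castSucc_le_castSucc_iff.mpr hpq)) _)
      (fun q => sub_nonneg.mpr (hω (Fin.le_last _))) (fun r hr => hd r (hr.trans (Nat.le_succ k)))
    have h2 := mul_nonneg (h0 (Fin.last k)) (hd (k + 1) le_rfl)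
    simp only [Fin.castLE_rfl, id] at h2
    rw [Fin.sum_univ_castSucc] at h2 ⊢
    simp only [sub_mul, Finset.sum_sub_distrib, ← Finset.mul_sum] at h1
    linarith

/-- If the columns of `Z` satisfy `Zᴴ Z ≥ 1`, then `Z Zᴴ` dominates the orthogonal projection
`Z (Zᴴ Z)⁻¹ Zᴴ` of rank `k`; here the diagonals of both are compared. -/
theorem exists_projection_diag {m k : ℕ} (Z : Matrix (Fin m) (Fin k) ℂ)
    (hZ : (Zᴴ * Z - 1).PosSemidef) :
    ∃ p : Fin m → ℝ, (∀ l, 0 ≤ p l) ∧ (∀ l, p l ≤ 1) ∧ (∑ l, p l = k) ∧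
      ∀ l, p l ≤ ∑ q, Complex.normSq (Z l q) := by
  set M := Zᴴ * Z with hM
  have hMd : M.PosDef := by
    have := PosDef.one.add_posSemidef hZ
    rwa [add_sub_cancel] at this
  have hu : IsUnit M.det := (isUnit_iff_isUnit_det _).mp hMd.isUnit
  have hMi : (M⁻¹)ᴴ = M⁻¹ := hMd.inv.isHermitian
  set P := Z * M⁻¹ * Zᴴ with hP
  have hPP : P * P = P := by
    have : P * P = Z * (M⁻¹ * M) * M⁻¹ * Zᴴ := by rw [hP, hM]; simp only [Matrix.mul_assoc]
    rw [this, nonsing_inv_mul _ hu, Matrix.mul_one]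
  have hPH : Pᴴ = P := by
    rw [hP]
    simp only [conjTranspose_mul, conjTranspose_conjTranspose, hMi, Matrix.mul_assoc]
  have hdiag : ∀ l, P l l = ((∑ a, Complex.normSq (P l a) : ℝ) : ℂ) := by
    intro l
    conv_lhs => rw [← hPP, mul_apply]
    rw [Complex.ofReal_sum]
    refine Finset.sum_congr rfl fun a _ => ?_
    rw [← Complex.mul_conj]
    congr 1
    conv_lhs => rw [← hPH]
    rfl
  have hre : ∀ l, (P l l).re = ∑ a, Complex.normSq (P l a) := fun l => by
    rw [hdiag l, Complex.ofReal_re]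
  have h0 : ∀ l, 0 ≤ (P l l).re := fun l => by
    rw [hre]; exact Finset.sum_nonneg fun a _ => Complex.normSq_nonneg _
  have hdom : (Z * Zᴴ - P).PosSemidef := by
    have h1 : Z * Zᴴ - P =
        Z * M⁻¹ * ((M - 1)ᴴ * (M - 1) + (M - 1)) * (Z * M⁻¹)ᴴ := by
      have h2 : (M - 1)ᴴ * (M - 1) + (M - 1) = (M - 1) * M := by
        rw [hZ.1.eq]; noncomm_ring
      have h3 : M⁻¹ * ((M - 1) * M) * M⁻¹ = 1 - M⁻¹ := by
        rw [Matrix.mul_assoc, Matrix.mul_assoc, mul_nonsing_inv _ hu, Matrix.mul_one,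
          Matrix.mul_sub, nonsing_inv_mul _ hu, Matrix.mul_one]
      rw [h2, conjTranspose_mul, hMi]
      calc Z * Zᴴ - P = Z * (1 - M⁻¹) * Zᴴ := by
            rw [hP, Matrix.mul_sub, Matrix.sub_mul, Matrix.mul_one]
        _ = _ := by rw [← h3]; simp only [Matrix.mul_assoc]
    rw [h1]
    exact ((posSemidef_conjTranspose_mul_self _).add hZ).mul_mul_conjTranspose_same _
  refine ⟨fun l => (P l l).re, h0, ?_, ?_, ?_⟩
  · intro l
    have h1 : (P l l).re ^ 2 ≤ (P l l).re := by
      conv_rhs => rw [hre]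
      refine le_trans ?_ (Finset.single_le_sum (f := fun a => Complex.normSq (P l a))
        (fun a _ => Complex.normSq_nonneg _) (Finset.mem_univ l))
      simp only [Complex.normSq_apply]
      nlinarith [mul_self_nonneg (P l l).im]
    change (P l l).re ≤ 1
    nlinarith [h0 l]
  · have h1 : P.trace = k := by
      rw [hP, Matrix.trace_mul_comm, ← Matrix.mul_assoc, ← hM, mul_nonsing_inv _ hu]
      simp
    have h2 := congrArg Complex.re h1
    simpa [trace] using h2
  · intro l
    have h1 := (Complex.nonneg_iff.mp (hdom.diag_nonneg (i := l))).1
    rw [Matrix.sub_apply, Complex.sub_re, sub_nonneg] at h1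
    refine h1.trans (le_of_eq ?_)
    rw [mul_apply, Complex.re_sum]
    refine Finset.sum_congr rfl fun q _ => ?_
    rw [conjTranspose_apply, Complex.star_def, Complex.mul_conj, Complex.ofReal_re]

/-- Among all weights in `[0, 1]` of total `k`, the weighted sum of a monotone sequence is smallest
for the indicator of its first `k` terms. -/
theorem sum_initial_le_sum_weights {m k : ℕ} (hk : k ≤ m) (γ p : Fin m → ℝ) (hγ : Monotone γ)
    (h0 : ∀ l, 0 ≤ p l) (h1 : ∀ l, p l ≤ 1) (hs : ∑ l, p l = k) :
    ∑ q : Fin k, γ (Fin.castLE hk q) ≤ ∑ l, γ l * p l := by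
  have hind : ∀ f : Fin m → ℝ, ∑ q : Fin k, f (Fin.castLE hk q) =
      ∑ l : Fin m, if l.1 < k then f l else 0 := by
    intro f
    rw [← Finset.sum_filter]
    refine Finset.sum_bij (fun q _ => Fin.castLE hk q) ?_ ?_ ?_ ?_
    · intro q _; simp
    · intro a _ b _ hab; exact Fin.castLE_injective hk hab
    · intro l hl
      exact ⟨⟨l.1, (Finset.mem_filter.mp hl).2⟩, Finset.mem_univ _, rfl⟩
    · intros; rfl
  rcases Nat.eq_zero_or_pos k with rfl | hk0
  · have : ∀ l, p l = 0 := by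
      intro l
      exact (Finset.sum_eq_zero_iff_of_nonneg fun l _ => h0 l).mp (by simpa using hs) l
        (Finset.mem_univ _)
    simp [this]
  set c := γ ⟨k - 1, by omega⟩
  have hone : ∑ l : Fin m, (if l.1 < k then (1 : ℝ) else 0) = k := by
    rw [← hind fun _ => 1]; simp
  have hterm : 0 ≤ ∑ l : Fin m, (γ l - c) * (p l - if l.1 < k then 1 else 0) := by
    refine Finset.sum_nonneg fun l _ => ?_
    split_ifs with hl
    · refine mul_nonneg_of_nonpos_of_nonpos (sub_nonpos.mpr (hγ ?_)) (sub_nonpos.mpr (h1 l))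
      rw [Fin.le_def]; simp; omega
    · refine mul_nonneg (sub_nonneg.mpr (hγ ?_)) (by simpa using h0 l)
      rw [Fin.le_def]; simp; omega
  rw [hind]
  have hexp : ∑ l : Fin m, (γ l - c) * (p l - if l.1 < k then 1 else 0) =
      ∑ l, γ l * p l - (∑ l : Fin m, if l.1 < k then γ l else 0) -
        c * (∑ l, p l - ∑ l : Fin m, if l.1 < k then (1 : ℝ) else 0) := by
    rw [← Finset.sum_sub_distrib, ← Finset.sum_sub_distrib, Finset.mul_sum,
      ← Finset.sum_sub_distrib]
    refine Finset.sum_congr rfl fun l _ => ?_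
    split_ifs <;> ring
  rw [hexp, hs, hone, sub_self, mul_zero, sub_zero] at hterm
  linarith

section DiagonalBound

variable {σ : Type*} [Fintype σ] [DecidableEq σ]

/-- The unweighted lower bound: the trace of `Yᴴ diag(h) Y` under the constraint
`Yᴴ diag(β) Y = -1` is at least the sum of the `k` smallest quotients `h / |β|` over `β < 0`. The
rows of `Y` with `β > 0` only make the constraint on the remaining rows stronger. -/
theorem sum_initial_le_of_constraint (h β : σ → ℝ) (hh : ∀ i, 0 ≤ h i) {m k : ℕ} (hk : k ≤ m)
    (j : Fin m ≃ {i // β i < 0}) (hj : Monotone fun p => h (j p) / -β (j p))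
    (Y : Matrix σ (Fin k) ℂ) (hY : Yᴴ * diagonal (fun i => (β i : ℂ)) * Y = -1) :
    ∑ q : Fin k, h (j (Fin.castLE hk q)) / -β (j (Fin.castLE hk q)) ≤
      ∑ q, ∑ i, h i * Complex.normSq (Y i q) := by
  let Z : Matrix (Fin m) (Fin k) ℂ := Matrix.of fun p q => (√(-β (j p)) : ℂ) * Y (j p) q
  have hnegsum : ∀ f : σ → ℂ, ∑ p : Fin m, f (j p) = ∑ i, if β i < 0 then f i else 0 := by
    intro f
    rw [← Fintype.sum_subtype_add_sum_subtype (fun i => β i < 0), Finset.sum_eq_zero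
      (s := (Finset.univ : Finset {i // ¬ β i < 0})) fun i _ => by rw [if_neg i.2], add_zero,
      ← Equiv.sum_comp j]
    exact Finset.sum_congr rfl fun p _ => by rw [if_pos (j p).2]
  have hsqrt : ∀ p, ((√(-β (j p)) : ℝ) : ℂ) * ((√(-β (j p)) : ℝ) : ℂ) = ((-β (j p) : ℝ) : ℂ) := by
    intro p
    rw [← Complex.ofReal_mul, Real.mul_self_sqrt (by linarith [(j p).2])]
  have hZZ : Zᴴ * Z - 1 = Yᴴ * diagonal (fun i => ((max (β i) 0 : ℝ) : ℂ)) * Y := by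
    rw [sub_eq_add_neg, ← hY]
    ext a b
    have hdiag : ∀ x : σ → ℝ, (Yᴴ * diagonal (fun i => (x i : ℂ)) * Y) a b =
        ∑ i, (x i : ℂ) * (star (Y i a) * Y i b) := by
      intro x
      rw [mul_apply]
      refine Finset.sum_congr rfl fun i _ => ?_
      rw [mul_diagonal, conjTranspose_apply]
      ring
    rw [Matrix.add_apply, hdiag, hdiag fun i => max (β i) 0, mul_apply]
    simp only [conjTranspose_apply, Z, of_apply]
    have h1 : ∀ p, star ((√(-β (j p)) : ℂ) * Y (j p) a) * ((√(-β (j p)) : ℂ) * Y (j p) b) =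
        (fun i => ((-β i : ℝ) : ℂ) * (star (Y i a) * Y i b)) (j p) := by
      intro p
      simp only
      rw [← hsqrt, star_mul', Complex.star_def, Complex.conj_ofReal]
      ring
    rw [(Finset.sum_congr rfl fun p _ => h1 p).trans
      (hnegsum fun i => ((-β i : ℝ) : ℂ) * (star (Y i a) * Y i b)), ← Finset.sum_add_distrib]
    refine Finset.sum_congr rfl fun i _ => ?_
    split_ifs with hi
    · rw [max_eq_right hi.le]; push_cast; ring
    · rw [max_eq_left (not_lt.mp hi)]; ring
  have hpsd : (Zᴴ * Z - 1).PosSemidef := by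
    rw [hZZ]
    refine PosSemidef.conjTranspose_mul_mul_same (PosSemidef.diagonal fun i => ?_) _
    simp
  obtain ⟨p, hp0, hp1, hps, hpZ⟩ := exists_projection_diag Z hpsd
  refine (sum_initial_le_sum_weights hk _ p hj hp0 hp1 hps).trans ?_
  have h2 : ∀ l, h (j l) / -β (j l) * p l ≤ ∑ q, h (j l) * Complex.normSq (Y (j l) q) := by
    intro l
    have hb : 0 < -β (j l) := by linarith [(j l).2]
    refine (mul_le_mul_of_nonneg_left (hpZ l) (div_nonneg (hh _) hb.le)).trans (le_of_eq ?_)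
    rw [Finset.mul_sum]
    refine Finset.sum_congr rfl fun q _ => ?_
    simp only [Z, of_apply, Complex.normSq_mul, Complex.normSq_ofReal, Real.mul_self_sqrt hb.le]
    rw [← mul_assoc, div_mul_cancel₀ _ hb.ne']
  refine (Finset.sum_le_sum fun l _ => h2 l).trans ?_
  rw [Finset.sum_comm]
  refine Finset.sum_le_sum fun q _ => ?_
  rw [Equiv.sum_comp j (fun i : {i // β i < 0} => h i * Complex.normSq (Y i q)),
    ← Fintype.sum_subtype_add_sum_subtype (fun i => β i < 0) fun i => h i * Complex.normSq (Y i q)]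
  exact le_add_of_nonneg_right
    (Finset.sum_nonneg fun i _ => mul_nonneg (hh _) (Complex.normSq_nonneg _))

theorem weighted_sum_initial_le_of_constraint (h β : σ → ℝ) (hh : ∀ i, 0 ≤ h i) {m k : ℕ}
    (hk : k ≤ m) (j : Fin m ≃ {i // β i < 0}) (hj : Monotone fun p => h (j p) / -β (j p))
    (ω : Fin k → ℝ) (hω : Antitone ω) (hω0 : ∀ i, 0 ≤ ω i)
    (Y : Matrix σ (Fin k) ℂ) (hY : Yᴴ * diagonal (fun i => (β i : ℂ)) * Y = -1) :
    ∑ q : Fin k, ω q * (h (j (Fin.castLE hk q)) / -β (j (Fin.castLE hk q))) ≤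
      ∑ q, ω q * ∑ i, h i * Complex.normSq (Y i q) := by
  rw [← sub_nonneg, ← Finset.sum_sub_distrib]
  simp only [← mul_sub]
  refine sum_mul_nonneg_of_partialSums k ω _ hω hω0 fun r hr => ?_
  rw [Finset.sum_sub_distrib, sub_nonneg]
  refine sum_initial_le_of_constraint h β hh (hr.trans hk) j hj (Y.submatrix id (Fin.castLE hr)) ?_
  have h1 := congrArg (fun M => M.submatrix (Fin.castLE hr) (Fin.castLE hr)) hY
  simp only [submatrix_neg, Pi.neg_apply, submatrix_one _ (Fin.castLE_injective hr)] at h1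
  exact h1

end DiagonalBound

/-! ### Congruence of a positive semi-definite pencil to a normal form -/

/-- The matrix with all entries `1` in each `2 × 2` block and `0` elsewhere: the coefficient of `s`
in `normA a t s`. It is written as a Gram matrix to make its positivity plain. -/
def normE (ι κ : Type) [DecidableEq κ] [Fintype κ] : Matrix (ι ⊕ (κ ⊕ κ)) (ι ⊕ (κ ⊕ κ)) ℂ :=
  (fromCols (0 : Matrix κ ι ℂ) (fromCols 1 1))ᴴ * fromCols (0 : Matrix κ ι ℂ) (fromCols 1 1)

theorem normE_posSemidef {ι κ : Type} [DecidableEq κ] [Fintype ι] [Fintype κ] : (normE ι κ).PosSemidef :=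
  posSemidef_conjTranspose_mul_self _

theorem normA_eq_add {ι κ : Type} [DecidableEq ι] [DecidableEq κ] [Fintype κ]
    (a : ι → ℝ) (t s : ℝ) :
    normA (κ := κ) a t s = diagonal (fun i => ((diagA a t i : ℝ) : ℂ)) + (s : ℂ) • normE ι κ := by
  ext (i | i | i) (j | j | j) <;>
    simp [normA, normE, diagA, mul_apply, diagonal_apply, one_apply, fromCols]
  all_goals split_ifs <;> simp_all [eq_comm] <;> ring

theorem normA_add {ι κ : Type} [DecidableEq ι] [DecidableEq κ]
    (h b : ι → ℝ) (t s : ℝ) :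
    normA (κ := κ) h 0 s + (t : ℂ) • normB b = normA (fun i => h i + t * b i) t s := by
  ext (i | i | i) (j | j | j) <;> simp [normA, normB, diagonal_apply, one_apply]
  all_goals split_ifs <;> ring

theorem diagA_sub_nonneg {ι κ : Type} {a b : ι → ℝ} {t : ℝ} (h : ∀ i, 0 ≤ a i - t * b i)
    (i : ι ⊕ (κ ⊕ κ)) :
    0 ≤ diagA a t i - t * diagB b i := by
  rcases i with i | i | i
  · exact h i
  · simp [diagA, diagB]
  · simp [diagA, diagB]

theorem of_conjTranspose_mul_mul_apply {d : ℕ} {σ : Type*} (M : Matrix (Fin d) (Fin d) ℂ)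
    (w : σ → Fin d → ℂ) (i j : σ) :
    ((Matrix.of fun x i => w i x)ᴴ * M * Matrix.of fun x i => w i x) i j = sesq M (w i) (w j) := by
  rw [Matrix.mul_assoc, mul_apply]
  simp [sesq, dotProduct, mulVec, mul_apply]

/-- The normal form of `A - t B` and `B`, shifted back to `A`. The matrix `U` may have more columns
than rows, since a spanning family with these Gram matrices can contain redundant vectors. -/
theorem exists_congr_normalForm {n : ℕ} {A B : Matrix (Fin n) (Fin n) ℂ} {t : ℝ}
    (hH : (A - (t : ℂ) • B).PosSemidef) (hB : B.IsHermitian) :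
    ∃ (ι κ : Type) (_ : Fintype ι) (_ : DecidableEq ι) (_ : Fintype κ) (_ : DecidableEq κ)
      (a b : ι → ℝ), (∀ i, 0 ≤ a i - t * b i) ∧ ∀ s : ℝ, 0 < s →
        ∃ (U : Matrix (Fin n) (ι ⊕ (κ ⊕ κ)) ℂ) (V : Matrix (ι ⊕ (κ ⊕ κ)) (Fin n) ℂ), U * V = 1 ∧
          Uᴴ * A * U = normA a t s ∧ Uᴴ * B * U = normB b := by
  obtain ⟨ι, κ, i1, i2, i3, i4, h, b, hh, hw⟩ := hasNormalForm n _ B hH hB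
  refine ⟨ι, κ, i1, i2, i3, i4, fun i => h i + t * b i, b, fun i => by simpa using hh i, ?_⟩
  intro s hs
  obtain ⟨w, hsp, hwH, hwB⟩ := hw s hs
  have hc : ∀ x : Fin n, ∃ c : ι ⊕ (κ ⊕ κ) → ℂ, ∑ i, c i • w i = Pi.single x 1 := fun x =>
    (Submodule.mem_span_range_iff_exists_fun ℂ).mp (hsp (Submodule.mem_top))
  choose c hc using hc
  have hUB : (Matrix.of fun x i => w i x)ᴴ * B * (Matrix.of fun x i => w i x) =
      normB (κ := κ) b := by
    ext i j
    rw [of_conjTranspose_mul_mul_apply, hwB]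
  have hUH : (Matrix.of fun x i => w i x)ᴴ * (A - (t : ℂ) • B) * (Matrix.of fun x i => w i x) =
      normA (κ := κ) h 0 s := by
    ext i j
    rw [of_conjTranspose_mul_mul_apply, hwH]
  refine ⟨Matrix.of fun x i => w i x, Matrix.of fun i x => c x i, ?_, ?_, hUB⟩
  · ext x y
    have := congrFun (hc y) x
    simp only [Finset.sum_apply, Pi.smul_apply, smul_eq_mul] at this
    rw [mul_apply, one_apply]
    simp only [of_apply, mul_comm (w _ x)]
    rw [this, Pi.single_apply]
  · rw [← normA_add, ← hUH, ← hUB]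
    simp only [Matrix.mul_sub, Matrix.sub_mul, Matrix.mul_smul, Matrix.smul_mul, sub_add_cancel]

/-! ### Frames and values of the objective -/

section Frames

variable {n k : ℕ} {A B : Matrix (Fin n) (Fin n) ℂ}

theorem traceObjective_eq_sum {D Q : Matrix (Fin k) (Fin k) ℂ} (hQ : Q ∈ unitaryGroup (Fin k) ℂ)
    {ω : Fin k → ℝ} (hQD : Qᴴ * D * Q = diagonal (fun i => (ω i : ℂ)))
    (X : Matrix (Fin n) (Fin k) ℂ) :
    traceObjective A D X = ∑ q, ω q * (sesq A ((X * Q).col q) ((X * Q).col q)).re := by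
  have hQQ : Q * Qᴴ = 1 := mem_unitaryGroup_iff.mp hQ
  have h1 : (D * Xᴴ * A * X).trace =
      (diagonal (fun i => (ω i : ℂ)) * ((X * Q)ᴴ * A * (X * Q))).trace := by
    have h2 : diagonal (fun i => (ω i : ℂ)) * ((X * Q)ᴴ * A * (X * Q)) =
        Qᴴ * (D * (Q * Qᴴ) * Xᴴ * A * X * Q) := by
      rw [← hQD, conjTranspose_mul]; simp only [Matrix.mul_assoc]
    rw [h2, trace_mul_comm Qᴴ, hQQ, Matrix.mul_one, Matrix.mul_assoc _ Q, hQQ, Matrix.mul_one]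
  rw [traceObjective, h1, trace, Complex.re_sum]
  refine Finset.sum_congr rfl fun q _ => ?_
  rw [diag_apply, diagonal_mul, Complex.re_ofReal_mul]
  congr 2
  exact of_conjTranspose_mul_mul_apply A (fun q => (X * Q).col q) q q

theorem sesq_col_of_constraint {Q : Matrix (Fin k) (Fin k) ℂ} (hQ : Q ∈ unitaryGroup (Fin k) ℂ)
    {X : Matrix (Fin n) (Fin k) ℂ} (hX : Xᴴ * B * X = -1) :
    (X * Q)ᴴ * B * (X * Q) = -1 := by
  have hQQ : Qᴴ * Q = 1 := mem_unitaryGroup_iff'.mp hQ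
  have : (X * Q)ᴴ * B * (X * Q) = Qᴴ * (Xᴴ * B * X) * Q := by
    rw [conjTranspose_mul]; simp only [Matrix.mul_assoc]
  rw [this, hX, Matrix.mul_neg, Matrix.neg_mul, Matrix.mul_one, hQQ]

/-- Every family `y` that is orthonormal for `-B` consists of the columns of `X Q` for a feasible
`X`. -/
theorem exists_of_frame {Q : Matrix (Fin k) (Fin k) ℂ} (hQ : Q ∈ unitaryGroup (Fin k) ℂ)
    (y : Fin k → Fin n → ℂ) (hy : ∀ p q, sesq B (y p) (y q) = if p = q then -1 else 0) :
    ∃ X : Matrix (Fin n) (Fin k) ℂ, Xᴴ * B * X = -1 ∧ ∀ q, (X * Q).col q = y q := by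
  have hQQ : Qᴴ * Q = 1 := mem_unitaryGroup_iff'.mp hQ
  have hQQ' : Q * Qᴴ = 1 := mem_unitaryGroup_iff.mp hQ
  set Y : Matrix (Fin n) (Fin k) ℂ := Matrix.of fun x q => y q x with hY
  have hYB : Yᴴ * B * Y = -1 := by
    ext p q
    rw [hY, of_conjTranspose_mul_mul_apply, hy, Matrix.neg_apply, one_apply]
    split_ifs <;> simp
  refine ⟨Y * Qᴴ, ?_, fun q => ?_⟩
  · have : (Y * Qᴴ)ᴴ * B * (Y * Qᴴ) = Q * (Yᴴ * B * Y) * Qᴴ := by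
      rw [conjTranspose_mul, conjTranspose_conjTranspose]; simp only [Matrix.mul_assoc]
    rw [this, hYB, Matrix.mul_neg, Matrix.neg_mul, Matrix.mul_one, hQQ']
  · rw [Matrix.mul_assoc, hQQ, Matrix.mul_one]
    rfl

/-- The columns of `U` with `β < 0`, normalized, are orthonormal for `-B`. -/
theorem sesq_normalized_col {ι κ : Type} [DecidableEq ι] [DecidableEq κ] {b : ι → ℝ}
    {U : Matrix (Fin n) (ι ⊕ (κ ⊕ κ)) ℂ}
    (hUB : Uᴴ * B * U = normB b) {f : Fin k → ι ⊕ (κ ⊕ κ)} (hf : Function.Injective f)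
    (hneg : ∀ q, diagB b (f q) < 0) (p q : Fin k) :
    sesq B (((√(-diagB b (f p)))⁻¹ : ℂ) • U.col (f p)) (((√(-diagB b (f q)))⁻¹ : ℂ) • U.col (f q)) =
      if p = q then -1 else 0 := by
  have h1 : sesq B (U.col (f p)) (U.col (f q)) = normB b (f p) (f q) := by
    rw [← hUB]
    exact (of_conjTranspose_mul_mul_apply B (fun i => U.col i) (f p) (f q)).symm
  rw [sesq_smul_left, sesq_smul_right, h1, normB_eq_diagonal, diagonal_apply]
  by_cases hpq : p = q
  · subst hpq
    have hb : 0 < -diagB b (f p) := by linarith [hneg p]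
    have h2 : ((√(-diagB b (f p)) : ℝ) : ℂ) * ((√(-diagB b (f p)) : ℝ) : ℂ) =
        -((diagB b (f p) : ℝ) : ℂ) := by
      rw [← Complex.ofReal_mul, Real.mul_self_sqrt hb.le, Complex.ofReal_neg]
    have h3 : ((√(-diagB b (f p)) : ℝ) : ℂ) ≠ 0 := by
      exact_mod_cast (Real.sqrt_pos.mpr hb).ne'
    rw [if_pos rfl, if_pos rfl, star_inv₀, Complex.star_def, Complex.conj_ofReal]
    field_simp
    rw [sq, h2, neg_neg]
  · rw [if_neg hpq, if_neg fun h => hpq (hf h)]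
    simp

end Frames

/-! ### The infimum in terms of the normal form -/

section Values

variable {ι κ : Type} [DecidableEq ι] [DecidableEq κ] [Fintype ι] [Fintype κ]
  {n k : ℕ} {A B : Matrix (Fin n) (Fin n) ℂ}

/-- In the coordinates of a normal form the numbers `λ_i⁻` are the quotients `α / β` of the diagonal
entries with `β < 0`, in descending order. -/
theorem exists_enumeration_lambdaMinus {a b : ι → ℝ} {t s : ℝ}
    {U : Matrix (Fin n) (ι ⊕ (κ ⊕ κ)) ℂ} {V : Matrix (ι ⊕ (κ ⊕ κ)) (Fin n) ℂ}
    (hB : B.IsHermitian) (h : ∀ i, 0 ≤ a i - t * b i) (hUV : U * V = 1)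
    (hUA : Uᴴ * A * U = normA a t s) (hUB : Uᴴ * B * U = normB b) :
    ∃ j : Fin (negInertia hB) ≃ {i : ι ⊕ (κ ⊕ κ) // diagB b i < 0},
      (Antitone fun p => diagA a t (j p).1 / diagB b (j p).1) ∧
      ∀ p : Fin (negInertia hB),
        lambdaMinus A hB (p + 1) = diagA a t (j p).1 / diagB b (j p).1 := by
  have hcard := negInertia_eq_card hB _ U V hUV (hUB.trans (normB_eq_diagonal b))
  obtain ⟨j, hj1, hj2⟩ := exists_enumeration (diagA (κ := κ) a t) (diagB b) t (diagA_sub_nonneg h)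
    (negInertia hB) hcard
  refine ⟨j, hj1, fun p => ?_⟩
  rw [← hj2, lambdaMinus, sortedEigenvalues, finiteEigenvalues_of_normalForm a b t s U V hUV hUA hUB]
  congr 2
  rw [← Multiset.coe_mapAddMonoidHom, map_sum]
  refine Finset.sum_congr rfl fun i _ => ?_
  split_ifs <;> simp

/-- In the coordinates of a normal form, dropping the positive semi-definite part `s E` of `normA`
reduces the lower bound to the one for diagonal matrices, applied to `diagA - t diagB ≥ 0`. -/
theorem lower_bound_of_normalForm {a b : ι → ℝ} {t s : ℝ} (hs : 0 ≤ s)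
    {U : Matrix (Fin n) (ι ⊕ (κ ⊕ κ)) ℂ} {V : Matrix (ι ⊕ (κ ⊕ κ)) (Fin n) ℂ}
    (hB : B.IsHermitian) (hk : k ≤ negInertia hB) (h : ∀ i, 0 ≤ a i - t * b i) (hUV : U * V = 1)
    (hUA : Uᴴ * A * U = normA a t s) (hUB : Uᴴ * B * U = normB b)
    {ω : Fin k → ℝ} (hω : Antitone ω) (hω0 : ∀ q, 0 ≤ ω q) (Y : Matrix (Fin n) (Fin k) ℂ)
    (hY : Yᴴ * B * Y = -1) :
    -∑ q : Fin k, ω q * lambdaMinus A hB (q + 1) ≤ ∑ q, ω q * (sesq A (Y.col q) (Y.col q)).re := by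
  obtain ⟨j, hj, hjl⟩ := exists_enumeration_lambdaMinus hB h hUV hUA hUB
  set W : Matrix (ι ⊕ (κ ⊕ κ)) (Fin k) ℂ := V * Y with hW
  have hUW : U * W = Y := by rw [hW, ← Matrix.mul_assoc, hUV, Matrix.one_mul]
  have hcol : ∀ q, U *ᵥ W.col q = Y.col q := fun q => by
    rw [← hUW]; rfl
  have hWB : Wᴴ * diagonal (fun i => ((diagB (κ := κ) b i : ℝ) : ℂ)) * W = -1 := by
    rw [← normB_eq_diagonal, ← hUB]
    refine Eq.trans ?_ (hUW ▸ hY : (U * W)ᴴ * B * (U * W) = -1)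
    simp only [conjTranspose_mul, Matrix.mul_assoc]
  have hWBq : ∀ q, ∑ i, diagB b i * Complex.normSq (W i q) = -1 := by
    intro q
    have h1 := dotProduct_diagonal_mulVec (diagB b) (W.col q)
    have h2 : star (W.col q) ⬝ᵥ (diagonal (fun i => ((diagB (κ := κ) b i : ℝ) : ℂ)) *ᵥ W.col q) =
        (Wᴴ * diagonal (fun i => ((diagB (κ := κ) b i : ℝ) : ℂ)) * W) q q := by
      rw [Matrix.mul_assoc, mul_apply]
      simp [dotProduct, mulVec_diagonal]
    rw [h2, hWB] at h1
    simp only [Matrix.neg_apply, one_apply_eq] at h1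
    exact_mod_cast h1.symm
  have hA : ∀ q, ∑ i, diagA a t i * Complex.normSq (W i q) ≤ (sesq A (Y.col q) (Y.col q)).re := by
    intro q
    have h1 : sesq A (Y.col q) (Y.col q) =
        star (W.col q) ⬝ᵥ (normA a t s *ᵥ W.col q) := by
      rw [← hUA, ← hcol]
      simp only [sesq, ← mulVec_mulVec, star_mulVec, ← dotProduct_mulVec]
    rw [h1, normA_eq_add, add_mulVec, dotProduct_add, dotProduct_diagonal_mulVec, Complex.add_re,
      Complex.ofReal_re, smul_mulVec, dotProduct_smul, smul_eq_mul, Complex.re_ofReal_mul]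
    refine le_add_of_nonneg_right (mul_nonneg hs ?_)
    exact (Complex.nonneg_iff.mp (normE_posSemidef.dotProduct_mulVec_nonneg _)).1
  have hquot : ∀ i : {i : ι ⊕ (κ ⊕ κ) // diagB b i < 0},
      (diagA a t i.1 - t * diagB b i.1) / -diagB b i.1 = t - diagA a t i.1 / diagB b i.1 := by
    intro i
    have := i.2.ne
    field_simp
    ring
  have hmain := weighted_sum_initial_le_of_constraint
    (fun i : ι ⊕ (κ ⊕ κ) => diagA a t i - t * diagB b i) (diagB b) (diagA_sub_nonneg h) hk j
    (by
      intro p q hpq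
      simp only [hquot]
      exact sub_le_sub_left (hj hpq) t) ω hω hω0 W hWB
  simp only [hquot] at hmain
  rw [← Finset.sum_neg_distrib]
  have hl : ∀ q : Fin k, diagA a t (j (Fin.castLE hk q)).1 / diagB b (j (Fin.castLE hk q)).1 =
      lambdaMinus A hB (q + 1) := fun q => (hjl (Fin.castLE hk q)).symm
  simp only [hl] at hmain
  have hr : ∀ q, ∑ i, (diagA a t i - t * diagB b i) * Complex.normSq (W i q) =
      ∑ i, diagA a t i * Complex.normSq (W i q) + t := by
    intro q
    simp only [sub_mul, Finset.sum_sub_distrib, mul_assoc, ← Finset.mul_sum, hWBq]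
    ring
  simp only [hr, mul_sub, mul_add, Finset.sum_sub_distrib, Finset.sum_add_distrib] at hmain
  have h2 : ∑ q, ω q * ∑ i, diagA a t i * Complex.normSq (W i q) ≤
      ∑ q, ω q * (sesq A (Y.col q) (Y.col q)).re :=
    Finset.sum_le_sum fun q _ => mul_le_mul_of_nonneg_left (hA q) (hω0 q)
  rw [Finset.sum_neg_distrib]
  linarith

/-- The frame of the normalized columns of `U` that belong to `λ_1⁻, …, λ_k⁻` comes within
`s ∑ ω` of the lower bound, because a block of the normal form contributes at most `s`. -/
theorem exists_almost_optimal {a b : ι → ℝ} {t s : ℝ} (hs : 0 ≤ s)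
    {U : Matrix (Fin n) (ι ⊕ (κ ⊕ κ)) ℂ} {V : Matrix (ι ⊕ (κ ⊕ κ)) (Fin n) ℂ}
    (hB : B.IsHermitian) (hk : k ≤ negInertia hB) (h : ∀ i, 0 ≤ a i - t * b i) (hUV : U * V = 1)
    (hUA : Uᴴ * A * U = normA a t s) (hUB : Uᴴ * B * U = normB b) :
    ∃ y : Fin k → Fin n → ℂ, (∀ p q, sesq B (y p) (y q) = if p = q then -1 else 0) ∧
      ∀ q : Fin k, (sesq A (y q) (y q)).re ≤ -lambdaMinus A hB (q + 1) + s := by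
  obtain ⟨j, -, hjl⟩ := exists_enumeration_lambdaMinus hB h hUV hUA hUB
  refine ⟨_, sesq_normalized_col hUB (f := fun q => (j (Fin.castLE hk q)).1)
    (fun p q hpq => Fin.castLE_injective hk (j.injective (Subtype.ext hpq)))
    (fun q => (j (Fin.castLE hk q)).2), fun q => ?_⟩
  have hl : diagA a t (j (Fin.castLE hk q)).1 / diagB b (j (Fin.castLE hk q)).1 =
      lambdaMinus A hB (q + 1) := (hjl (Fin.castLE hk q)).symm
  rw [← hl]
  generalize (j (Fin.castLE hk q)) = i
  obtain ⟨i, hi⟩ := i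
  have hb : 0 < -diagB b i := by linarith
  have h1 : sesq A (U.col i) (U.col i) = normA a t s i i := by
    rw [← hUA]
    exact (of_conjTranspose_mul_mul_apply A (fun i => U.col i) i i).symm
  rw [sesq_smul_left, sesq_smul_right, h1, ← mul_assoc, star_inv₀, Complex.star_def,
    Complex.conj_ofReal, ← mul_inv, ← Complex.ofReal_mul, Real.mul_self_sqrt hb.le,
    ← Complex.ofReal_inv, Complex.re_ofReal_mul]
  rcases i with i | i | i
  · simp only [normA, diagA, diagB, fromBlocks_apply₁₁, diagonal_apply_eq, Complex.ofReal_re,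
      Sum.elim_inl]
    rw [inv_neg, neg_mul, inv_mul_eq_div]
    linarith
  · simp [diagB] at hi
    linarith
  · simp [normA, diagA, diagB]

end Values

/-! ### Unboundedness for an indefinite weight -/

/-- On the vectors `ζ` in the span of `x` and `z` with `ζᴴ B ζ = -1` the form of `H` is unbounded,
unless it vanishes on the `B`-isotropic vectors of this span. The vectors
`(x ± √u z) / √(1 - b u)` are used, the sign being chosen so that the mixed terms do not hurt. -/
theorem exists_large_value {n : ℕ} {H B : Matrix (Fin n) (Fin n) ℂ} (hH : H.PosSemidef)
    (hB : B.IsHermitian) {x z : Fin n → ℂ} {b : ℝ} (hb : 0 ≤ b) (hx : sesq B x x = -1)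
    (hxz : sesq B x z = 0) (hz : sesq B z z = b)
    (hpos : 0 < b * (sesq H x x).re + (sesq H z z).re) (c : ℝ) :
    ∃ α β : ℂ, sesq B (α • x + β • z) (α • x + β • z) = -1 ∧
      c ≤ (sesq H (α • x + β • z) (α • x + β • z)).re := by
  have hzx : sesq B z x = 0 := by rw [sesq_conj_symm hB x, hxz, star_zero]
  have hHx := sesq_self_nonneg hH x
  set S := b * (sesq H x x).re + (sesq H z z).re with hS
  set c' := max c 1 with hc'
  have hc1 : 0 < c' := lt_of_lt_of_le one_pos (le_max_right _ _)
  have hT : 0 < S + c' * b := by positivity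
  set u := c' / (S + c' * b) with hu
  have hu0 : 0 ≤ u := by positivity
  have hbu : 1 - b * u = S / (S + c' * b) := by rw [hu]; field_simp; ring
  have hbu0 : 0 < 1 - b * u := by rw [hbu]; positivity
  have hmain : c' * (1 - b * u) ≤ (sesq H x x).re + u * (sesq H z z).re := by
    rw [hbu, hu, mul_div_assoc', div_mul_eq_mul_div, ← sub_nonneg]
    have : (sesq H x x).re + c' * (sesq H z z).re / (S + c' * b) - c' * S / (S + c' * b) =
        (sesq H x x).re * S / (S + c' * b) := by
      rw [eq_div_iff hT.ne', sub_mul, add_mul, div_mul_cancel₀ _ hT.ne', div_mul_cancel₀ _ hT.ne',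
        hS]
      ring
    rw [this]
    positivity
  have hdd : ((√(1 - b * u) : ℝ) : ℂ) * ((√(1 - b * u) : ℝ) : ℂ) = ((1 - b * u : ℝ) : ℂ) := by
    rw [← Complex.ofReal_mul, Real.mul_self_sqrt hbu0.le]
  have hrr : ((√u : ℝ) : ℂ) * ((√u : ℝ) : ℂ) = (u : ℂ) := by
    rw [← Complex.ofReal_mul, Real.mul_self_sqrt hu0]
  -- Averaging over the two signs removes the mixed term.
  obtain ⟨ε, hε, hεm⟩ : ∃ ε : ℝ, ε * ε = 1 ∧ 0 ≤ ε * (√u * ((sesq H x z).re + (sesq H z x).re)) := by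
    rcases le_total 0 (√u * ((sesq H x z).re + (sesq H z x).re)) with h | h
    · exact ⟨1, by norm_num, by linarith⟩
    · exact ⟨-1, by norm_num, by linarith⟩
  have hεc : (ε : ℂ) * (ε : ℂ) = 1 := by exact_mod_cast hε
  set d : ℂ := ((√(1 - b * u) : ℝ) : ℂ)⁻¹ with hd
  have hdstar : star d = d := by rw [hd, star_inv₀, Complex.star_def, Complex.conj_ofReal]
  have hd2 : d * d = (((1 - b * u)⁻¹ : ℝ) : ℂ) := by
    rw [hd, ← mul_inv, hdd, Complex.ofReal_inv]
  set r : ℂ := ((ε * √u : ℝ) : ℂ) with hr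
  have hrstar : star r = r := by rw [hr, Complex.star_def, Complex.conj_ofReal]
  have hr2 : r * r = u := by
    rw [hr, Complex.ofReal_mul]
    linear_combination (ε : ℂ) * ε * hrr + (u : ℂ) * hεc
  have hexp : ∀ M : Matrix (Fin n) (Fin n) ℂ, sesq M (d • x + (d * r) • z) (d • x + (d * r) • z) =
      (((1 - b * u)⁻¹ : ℝ) : ℂ) *
        (sesq M x x + r * (sesq M x z + sesq M z x) + u * sesq M z z) := by
    intro M
    simp only [sesq_add_left, sesq_add_right, sesq_smul_left, sesq_smul_right, star_mul', hdstar,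
      hrstar]
    rw [← hd2, ← hr2]
    ring
  refine ⟨d, d * r, ?_, ?_⟩
  · rw [hexp, hx, hxz, hzx, hz]
    have : ((1 - b * u : ℝ) : ℂ) ≠ 0 := by exact_mod_cast hbu0.ne'
    rw [Complex.ofReal_inv, inv_mul_eq_iff_eq_mul₀ this]
    push_cast
    ring
  · rw [hexp, Complex.re_ofReal_mul, Complex.add_re, Complex.add_re, Complex.re_ofReal_mul,
      Complex.re_ofReal_mul, Complex.add_re]
    refine (le_max_left c 1).trans ?_
    rw [inv_mul_eq_div, le_div_iff₀ hbu0]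
    nlinarith [hmain, hεm]

section Unbounded

variable {ι κ : Type} [DecidableEq ι] [DecidableEq κ] [Fintype ι] [Fintype κ]
  {n k : ℕ} {A B : Matrix (Fin n) (Fin n) ℂ}

theorem exists_diagB_pos {b : ι → ℝ} {U : Matrix (Fin n) (ι ⊕ (κ ⊕ κ)) ℂ}
    {V : Matrix (ι ⊕ (κ ⊕ κ)) (Fin n) ℂ} (hB : B.IsHermitian) (hUV : U * V = 1)
    (hUB : Uᴴ * B * U = normB b) (hpos : ∃ i, 0 < hB.eigenvalues i) :
    ∃ i : ι ⊕ (κ ⊕ κ), 0 < diagB b i := by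
  by_contra! hle
  obtain ⟨i, hi⟩ := hpos
  have hneg : (-B).PosSemidef := by
    have h1 : -B = Vᴴ * diagonal (fun i => ((-diagB (κ := κ) b i : ℝ) : ℂ)) * V := by
      have h2 : (diagonal fun i => ((-diagB (κ := κ) b i : ℝ) : ℂ)) = -(Uᴴ * B * U) := by
        rw [hUB, normB_eq_diagonal, diagonal_neg]
        simp only [Complex.ofReal_neg]
      rw [h2, Matrix.mul_neg, Matrix.neg_mul, congr_cancel hUV]
    rw [h1]
    refine PosSemidef.conjTranspose_mul_mul_same (PosSemidef.diagonal fun i => ?_) _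
    exact Complex.zero_le_real.mpr (neg_nonneg.mpr (hle i))
  set v : Fin n → ℂ := (hB.eigenvectorBasis i).ofLp
  have hev : B *ᵥ v = (hB.eigenvalues i : ℂ) • v := by
    simpa using hB.mulVec_eigenvectorBasis i
  have hvv : star v ⬝ᵥ v = 1 := by
    have h1 := (orthonormal_iff_ite.mp hB.eigenvectorBasis.orthonormal) i i
    rw [if_pos rfl, EuclideanSpace.inner_eq_star_dotProduct, dotProduct_comm] at h1
    exact h1
  have h3 := (Complex.nonneg_iff.mp (hneg.dotProduct_mulVec_nonneg v)).1
  rw [neg_mulVec, dotProduct_neg, hev, dotProduct_smul, hvv] at h3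
  simp at h3
  linarith

/-- If some weight is negative, the corresponding vector of a frame can be moved towards a
`B`-isotropic direction in which `A - t B` does not vanish. -/
theorem not_bddBelow_of_neg_weight {b : ι → ℝ} {t : ℝ}
    {U : Matrix (Fin n) (ι ⊕ (κ ⊕ κ)) ℂ} {V : Matrix (ι ⊕ (κ ⊕ κ)) (Fin n) ℂ}
    (hH : (A - (t : ℂ) • B).PosSemidef) (hB : B.IsHermitian)
    (hk : k ≤ negInertia hB) (hpos : ∃ i, 0 < hB.eigenvalues i)
    (hUV : U * V = 1) (hUB : Uᴴ * B * U = normB b) (hne : A ≠ (t : ℂ) • B)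
    {ω : Fin k → ℝ} (q₀ : Fin k) (hq₀ : ω q₀ < 0) (c : ℝ) :
    ∃ y : Fin k → Fin n → ℂ, (∀ p q, sesq B (y p) (y q) = if p = q then -1 else 0) ∧
      ∑ q, ω q * (sesq A (y q) (y q)).re < c := by
  set H := A - (t : ℂ) • B with hHdef
  have hgram : ∀ i j, sesq B (U.col i) (U.col j) = normB b i j := fun i j => by
    rw [← hUB]
    exact (of_conjTranspose_mul_mul_apply B (fun i => U.col i) i j).symm
  -- Some column of `U` is not in the kernel of `H`.
  obtain ⟨l, hl⟩ : ∃ l, 0 < (sesq H (U.col l) (U.col l)).re := by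
    by_contra! hle
    have h0 : ∀ l, H *ᵥ U.col l = 0 := fun l =>
      mulVec_eq_zero_of_sesq_self hH (le_antisymm (hle l) (sesq_self_nonneg hH _))
    have hHU : H * U = 0 := by
      ext x l
      exact congrFun (h0 l) x
    have : H = 0 := by rw [← Matrix.mul_one H, ← hUV, ← Matrix.mul_assoc, hHU, Matrix.zero_mul]
    exact hne (sub_eq_zero.mp this)
  have hcard := negInertia_eq_card hB _ U V hUV (hUB.trans (normB_eq_diagonal b))
  let e : Fin (negInertia hB) ≃ {i : ι ⊕ (κ ⊕ κ) // diagB b i < 0} :=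
    (finCongr hcard).trans (Fintype.equivFin _).symm
  obtain ⟨f, hf, hfneg, i, hi, hHi⟩ : ∃ f : Fin k → ι ⊕ (κ ⊕ κ), Function.Injective f ∧
      (∀ q, diagB b (f q) < 0) ∧ ∃ i, 0 ≤ diagB b i ∧
        (0 < (sesq H (U.col i) (U.col i)).re ∨
          0 < diagB b i ∧ 0 < (sesq H (U.col (f q₀)) (U.col (f q₀))).re) := by
    rcases lt_or_ge (diagB b l) 0 with hbl | hbl
    · obtain ⟨i, hi⟩ := exists_diagB_pos hB hUV hUB hpos
      let e' := (Equiv.swap (Fin.castLE hk q₀) (e.symm ⟨l, hbl⟩)).trans e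
      refine ⟨fun q => (e' (Fin.castLE hk q)).1,
        fun p q hpq => Fin.castLE_injective hk (e'.injective (Subtype.ext hpq)),
        fun q => (e' (Fin.castLE hk q)).2, i, hi.le, Or.inr ⟨hi, ?_⟩⟩
      have : (e' (Fin.castLE hk q₀)).1 = l := by simp [e']
      simp only [this]
      exact hl
    · exact ⟨fun q => (e (Fin.castLE hk q)).1,
        fun p q hpq => Fin.castLE_injective hk (e.injective (Subtype.ext hpq)),
        fun q => (e (Fin.castLE hk q)).2, l, hbl, Or.inl hl⟩
  set y : Fin k → Fin n → ℂ := fun q => ((√(-diagB b (f q)))⁻¹ : ℂ) • U.col (f q) with hy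
  have hyy : ∀ p q, sesq B (y p) (y q) = if p = q then -1 else 0 :=
    sesq_normalized_col hUB hf hfneg
  have hyz : ∀ q, sesq B (y q) (U.col i) = 0 := by
    intro q
    have : f q ≠ i := fun h => by have := hfneg q; rw [h] at this; linarith
    rw [hy, sesq_smul_left, hgram, normB_eq_diagonal, diagonal_apply_ne _ this, mul_zero]
  have hzy : ∀ q, sesq B (U.col i) (y q) = 0 := fun q => by
    rw [sesq_conj_symm hB (y q), hyz, star_zero]
  have hzz : sesq B (U.col i) (U.col i) = (diagB b i : ℝ) := by
    rw [hgram, normB_eq_diagonal, diagonal_apply_eq]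
  have hpos' : 0 < diagB b i * (sesq H (y q₀) (y q₀)).re + (sesq H (U.col i) (U.col i)).re := by
    rcases hHi with h | ⟨h1, h2⟩
    · exact add_pos_of_nonneg_of_pos (mul_nonneg hi (sesq_self_nonneg hH _)) h
    · refine add_pos_of_pos_of_nonneg (mul_pos h1 ?_) (sesq_self_nonneg hH _)
      have hb : 0 < -diagB b (f q₀) := by linarith [hfneg q₀]
      rw [hy, sesq_smul_left, sesq_smul_right, ← mul_assoc, star_inv₀, Complex.star_def,
        Complex.conj_ofReal, ← mul_inv, ← Complex.ofReal_mul, Real.mul_self_sqrt hb.le,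
        ← Complex.ofReal_inv, Complex.re_ofReal_mul]
      positivity
  -- The contribution of the other columns and of the shift by `t`.
  set K := ∑ q ∈ Finset.univ.erase q₀, ω q * (sesq A (y q) (y q)).re with hK
  obtain ⟨α, β, hζB, hζH⟩ := exists_large_value hH hB hi (by rw [hyy, if_pos rfl]) (hyz q₀) hzz
    hpos' (t + (c - K - 1) / ω q₀)
  set ζ := α • y q₀ + β • U.col i with hζ
  refine ⟨Function.update y q₀ ζ, ?_, ?_⟩
  · intro p q
    by_cases hp : p = q₀ <;> by_cases hq : q = q₀
    · subst hp; subst hq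
      simp [hζB]
    · subst hp
      rw [Function.update_self, Function.update_of_ne hq, if_neg (Ne.symm hq), hζ, sesq_add_left,
        sesq_smul_left α, sesq_smul_left β, hyy, hzy, if_neg (Ne.symm hq)]
      simp
    · subst hq
      rw [Function.update_self, Function.update_of_ne hp, if_neg hp, hζ, sesq_add_right,
        sesq_smul_right α, sesq_smul_right β, hyy, hyz, if_neg hp]
      simp
    · rw [Function.update_of_ne hp, Function.update_of_ne hq, hyy]
  · have hAζ : (sesq A ζ ζ).re = (sesq H ζ ζ).re - t := by
      have : sesq H ζ ζ = sesq A ζ ζ - t * sesq B ζ ζ := by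
        simp [sesq, hHdef, sub_mulVec, smul_mulVec, dotProduct_sub]
      rw [this, hζB]
      simp
    rw [← Finset.add_sum_erase _ _ (Finset.mem_univ q₀), Function.update_self,
      Finset.sum_congr rfl (g := fun q => ω q * (sesq A (y q) (y q)).re) fun q hq => by
        rw [Function.update_of_ne (Finset.ne_of_mem_erase hq)], ← hK, hAζ]
    have h1 : (c - K - 1) / ω q₀ ≤ (sesq H ζ ζ).re - t := by linarith
    have h2 := mul_le_mul_of_nonpos_left h1 hq₀.le
    rw [mul_div_cancel₀ _ hq₀.ne] at h2
    linarith

end Unbounded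

/-! ### Diagonalizable pencils -/

/-- For a diagonalizable pencil the normal form has no `2 × 2` blocks. -/
theorem exists_congr_normalForm_of_diagonalizable {n : ℕ} {A B : Matrix (Fin n) (Fin n) ℂ} {t : ℝ}
    (hA : A.IsHermitian) (hB : B.IsHermitian) (hH : (A - (t : ℂ) • B).PosSemidef)
    (hdiag : IsDiagonalizablePencil A B) :
    ∃ (a b : Fin n → ℝ) (U : Matrix (Fin n) (Fin n ⊕ (Empty ⊕ Empty)) ℂ)
      (V : Matrix (Fin n ⊕ (Empty ⊕ Empty)) (Fin n) ℂ), (∀ i, 0 ≤ a i - t * b i) ∧ U * V = 1 ∧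
        Uᴴ * A * U = normA a t 0 ∧ Uᴴ * B * U = normB b := by
  obtain ⟨T, hT, hTA, hTB⟩ := hdiag
  have hreal : ∀ M : Matrix (Fin n) (Fin n) ℂ, M.IsHermitian → (Tᴴ * M * T).IsDiag →
      ∀ i j, (Tᴴ * M * T) i j = if i = j then (((Tᴴ * M * T) i i).re : ℂ) else 0 := by
    intro M hM hd i j
    split_ifs with h
    · subst h
      exact ((isHermitian_conjTranspose_mul_mul T hM).coe_re_apply_self i).symm
    · exact hd h
  set a : Fin n → ℝ := fun i => ((Tᴴ * A * T) i i).re with ha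
  set b : Fin n → ℝ := fun i => ((Tᴴ * B * T) i i).re with hb
  let c : Fin n ⊕ (Empty ⊕ Empty) → Fin n := Sum.elim id (Sum.elim Empty.elim Empty.elim)
  have hsub : ∀ M : Matrix (Fin n) (Fin n) ℂ,
      (T.submatrix id c)ᴴ * M * T.submatrix id c = (Tᴴ * M * T).submatrix c c := fun M => rfl
  refine ⟨a, b, T.submatrix id c, T⁻¹.submatrix c id, fun i => ?_, ?_, ?_, ?_⟩
  · have h1 := (Complex.nonneg_iff.mp ((hH.conjTranspose_mul_mul_same T).diag_nonneg (i := i))).1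
    have h2 : Tᴴ * (A - (t : ℂ) • B) * T = Tᴴ * A * T - (t : ℂ) • (Tᴴ * B * T) := by
      simp [Matrix.mul_sub, Matrix.sub_mul]
    rw [h2, Matrix.sub_apply, Matrix.smul_apply, smul_eq_mul, Complex.sub_re,
      Complex.re_ofReal_mul] at h1
    exact h1
  · have h1 : T.submatrix id c * T⁻¹.submatrix c id = T * T⁻¹ := by
      ext i j
      simp [mul_apply, c]
    rw [h1, mul_nonsing_inv _ ((isUnit_iff_isUnit_det _).mp hT)]
  · rw [hsub]
    ext (i | i | i) (j | j | j)
    · simp [normA, c, hreal A hA hTA i j, diagonal_apply, ha]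
    all_goals first | exact i.elim | exact j.elim
  · rw [hsub]
    ext (i | i | i) (j | j | j)
    · simp [normB, c, hreal B hB hTB i j, diagonal_apply, hb]
    all_goals first | exact i.elim | exact j.elim

/-- The normalized basis vectors that realize `λ_1⁻, …, λ_k⁻` are eigenvectors when the normal form
is diagonal. -/
theorem exists_eigenvector_frame {n k : ℕ} {A B : Matrix (Fin n) (Fin n) ℂ} {t : ℝ}
    (hA : A.IsHermitian) (hB : B.IsHermitian) (hH : (A - (t : ℂ) • B).PosSemidef)
    (hk : k ≤ negInertia hB) (hdiag : IsDiagonalizablePencil A B) :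
    ∃ y : Fin k → Fin n → ℂ, (∀ p q, sesq B (y p) (y q) = if p = q then -1 else 0) ∧
      ∀ q : Fin k, IsEigenvector A B (lambdaMinus A hB (q + 1)) (y q) := by
  obtain ⟨a, b, U, V, hh, hUV, hUA, hUB⟩ :=
    exists_congr_normalForm_of_diagonalizable hA hB hH hdiag
  obtain ⟨j, -, hjl⟩ := exists_enumeration_lambdaMinus hB hh hUV hUA hUB
  have hgram := sesq_normalized_col hUB (f := fun q => (j (Fin.castLE hk q)).1)
    (fun p q hpq => Fin.castLE_injective hk (j.injective (Subtype.ext hpq)))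
    (fun q => (j (Fin.castLE hk q)).2)
  refine ⟨_, hgram, fun q => ?_⟩
  have hself := hgram q q
  rw [if_pos rfl] at hself
  have hBne : B *ᵥ (((√(-diagB b (j (Fin.castLE hk q)).1))⁻¹ : ℂ) •
      U.col (j (Fin.castLE hk q)).1) ≠ 0 := by
    intro h0
    rw [sesq_of_mulVec_eq_zero h0] at hself
    norm_num at hself
  have hl : lambdaMinus A hB (q + 1) = diagA a t (j (Fin.castLE hk q)).1 /
      diagB b (j (Fin.castLE hk q)).1 := hjl (Fin.castLE hk q)
  refine ⟨?_, fun h0 => hBne (by rw [h0, mulVec_zero]), fun h0 => hBne h0.2, ?_⟩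
  · rw [← mem_finiteEigenvalues, finiteEigenvalues_of_normalForm a b t 0 U V hUV hUA hUB,
      Multiset.mem_sum]
    refine ⟨(j (Fin.castLE hk q)).1, Finset.mem_univ _, ?_⟩
    rw [if_neg (j (Fin.castLE hk q)).2.ne, Multiset.mem_singleton, hl]
  · rw [mulVec_smul, mulVec_smul, smul_comm]
    congr 1
    rw [hl]
    generalize j (Fin.castLE hk q) = i
    obtain ⟨i, hi⟩ := i
    -- The columns of the difference are annihilated by `Uᴴ`, which is injective.
    have h1 : Uᴴ *ᵥ (A *ᵥ U.col i - ((diagA a t i / diagB b i : ℝ) : ℂ) • B *ᵥ U.col i) = 0 := by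
      have h2 : ∀ M : Matrix (Fin n) (Fin n) ℂ, Uᴴ *ᵥ (M *ᵥ U.col i) = (Uᴴ * M * U).col i := by
        intro M
        rw [mulVec_mulVec]
        rfl
      rw [mulVec_sub, mulVec_smul, h2, h2, hUA, hUB, normA_eq_add, normB_eq_diagonal]
      ext l
      simp only [Complex.ofReal_zero, zero_smul, add_zero, Pi.sub_apply, Pi.smul_apply, col_apply,
        diagonal_apply, smul_eq_mul, Pi.zero_apply]
      split_ifs with h
      · subst h
        rw [← Complex.ofReal_mul, div_mul_cancel₀ _ hi.ne, sub_self]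
      · simp
    have hVU : Vᴴ * Uᴴ = 1 := by rw [← conjTranspose_mul, hUV, conjTranspose_one]
    have h3 := congrArg (fun v => Vᴴ *ᵥ v) h1
    simp only [mulVec_mulVec, hVU, one_mulVec, mulVec_zero] at h3
    exact sub_eq_zero.mp h3

/-! ### The infimum -/

theorem posSemidef_iff_weights_nonneg {k : ℕ} {D Q : Matrix (Fin k) (Fin k) ℂ}
    (hQ : Q ∈ unitaryGroup (Fin k) ℂ) {ω : Fin k → ℝ}
    (hQD : Qᴴ * D * Q = diagonal (fun i => (ω i : ℂ))) :
    D.PosSemidef ↔ ∀ q, 0 ≤ ω q := by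
  have hQQ : Q * Qᴴ = 1 := mem_unitaryGroup_iff.mp hQ
  constructor
  · intro h q
    have h1 := h.conjTranspose_mul_mul_same Q
    rw [hQD, posSemidef_diagonal_iff] at h1
    exact Complex.zero_le_real.mp (h1 q)
  · intro h
    have h1 : D = Q * diagonal (fun i => (ω i : ℂ)) * Qᴴ := by
      rw [← hQD]
      calc D = (Q * Qᴴ) * D * (Q * Qᴴ) := by rw [hQQ, Matrix.one_mul, Matrix.mul_one]
        _ = _ := by simp only [Matrix.mul_assoc]
    rw [h1]
    refine PosSemidef.mul_mul_conjTranspose_same (PosSemidef.diagonal fun i => ?_) _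
    exact Complex.zero_le_real.mpr (h i)

theorem isGLB_negValues {n k : ℕ} {A B : Matrix (Fin n) (Fin n) ℂ} {D Q : Matrix (Fin k) (Fin k) ℂ}
    {t : ℝ} (hH : (A - (t : ℂ) • B).PosSemidef) (hB : B.IsHermitian) (hk : k ≤ negInertia hB)
    (hQ : Q ∈ unitaryGroup (Fin k) ℂ) {ω : Fin k → ℝ} (hω : Antitone ω) (hω0 : ∀ q, 0 ≤ ω q)
    (hQD : Qᴴ * D * Q = diagonal (fun i => (ω i : ℂ))) :
    IsGLB (negValues A B D) (-∑ i : Fin k, ω i * lambdaMinus A hB (i + 1)) := by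
  obtain ⟨ι, κ, _, _, _, _, a, b, hh, hUV⟩ := exists_congr_normalForm hH hB
  constructor
  · rintro _ ⟨X, hX, rfl⟩
    obtain ⟨U, V, hUV, hUA, hUB⟩ := hUV 1 one_pos
    rw [traceObjective_eq_sum hQ hQD]
    exact lower_bound_of_normalForm zero_le_one hB hk hh hUV hUA hUB hω hω0 (X * Q)
      (sesq_col_of_constraint hQ hX)
  · intro v hv
    refine le_of_forall_pos_le_add fun ε hε => ?_
    have hsum : 0 ≤ ∑ q, ω q := Finset.sum_nonneg fun q _ => hω0 q
    set s := ε / (∑ q, ω q + 1) with hs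
    have hs0 : 0 < s := by positivity
    obtain ⟨U, V, hUV, hUA, hUB⟩ := hUV s hs0
    obtain ⟨y, hy, hyA⟩ := exists_almost_optimal hs0.le hB hk hh hUV hUA hUB
    obtain ⟨X, hX, hXy⟩ := exists_of_frame hQ y hy
    refine (hv ⟨X, hX, rfl⟩).trans ?_
    rw [traceObjective_eq_sum hQ hQD]
    simp only [hXy]
    calc ∑ q, ω q * (sesq A (y q) (y q)).re
        ≤ ∑ q : Fin k, ω q * (-lambdaMinus A hB (q + 1) + s) :=
          Finset.sum_le_sum fun q _ => mul_le_mul_of_nonneg_left (hyA q) (hω0 q)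
      _ = -∑ q : Fin k, ω q * lambdaMinus A hB (q + 1) + (∑ q, ω q) * s := by
          simp only [mul_add, mul_neg, Finset.sum_add_distrib, Finset.sum_neg_distrib,
            ← Finset.sum_mul]
      _ ≤ _ := by
          have : (∑ q, ω q) * s ≤ ε := by
            rw [hs, mul_div_assoc', div_le_iff₀ (by positivity)]
            nlinarith
          linarith

end TraceMin

end

theorem mainTheorem4 (n k : ℕ) (A B : Matrix (Fin n) (Fin n) ℂ) (D : Matrix (Fin k) (Fin k) ℂ)
    (hAB : TraceMin.IsPosSemidefPencil A B) (hB : B.IsHermitian)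
    (hind : TraceMin.IsGenuinelyIndefinite hB) (hk : k ≤ TraceMin.negInertia hB)
    (hD : D.IsHermitian) (Q : Matrix (Fin k) (Fin k) ℂ) (hQ : Q ∈ Matrix.unitaryGroup (Fin k) ℂ)
    (ω : Fin k → ℝ) (hω : Antitone ω)
    (hQD : Qᴴ * D * Q = Matrix.diagonal (fun i => (ω i : ℂ))) :
    ((∀ c : ℝ, A ≠ (c : ℂ) • B) →
      (BddBelow (TraceMin.negValues A B D) ↔ D.PosSemidef)) ∧
    (D.PosSemidef →
      IsGLB (TraceMin.negValues A B D)
        (-∑ i : Fin k, ω i * TraceMin.lambdaMinus A hB (i + 1))) ∧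
    (D.PosSemidef → TraceMin.IsDiagonalizablePencil A B →
      (∃ X : Matrix (Fin n) (Fin k) ℂ, Xᴴ * B * X = -1 ∧
        ∀ i : Fin k,
          TraceMin.IsEigenvector A B (TraceMin.lambdaMinus A hB (i + 1)) ((X * Q).col i)) ∧
      ∀ X : Matrix (Fin n) (Fin k) ℂ, Xᴴ * B * X = -1 →
        (∀ i : Fin k,
          TraceMin.IsEigenvector A B (TraceMin.lambdaMinus A hB (i + 1)) ((X * Q).col i)) →
        TraceMin.traceObjective A D X =
          -∑ i : Fin k, ω i * TraceMin.lambdaMinus A hB (i + 1)) := by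
  obtain ⟨hA, -, t, hH⟩ := hAB
  have hDω := TraceMin.posSemidef_iff_weights_nonneg hQ hQD
  have hglb : D.PosSemidef → IsGLB (TraceMin.negValues A B D)
      (-∑ i : Fin k, ω i * TraceMin.lambdaMinus A hB (i + 1)) := fun h =>
    TraceMin.isGLB_negValues hH hB hk hQ hω (hDω.mp h) hQD
  refine ⟨fun hne => ⟨fun hbdd => ?_, fun h => ⟨_, (hglb h).1⟩⟩, hglb, fun _ hdiag => ⟨?_, ?_⟩⟩
  · rw [hDω]
    by_contra! hneg
    obtain ⟨q₀, hq₀⟩ := hneg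
    obtain ⟨c, hc⟩ := hbdd
    obtain ⟨ι, κ, _, _, _, _, a, b, -, hUV⟩ := TraceMin.exists_congr_normalForm hH hB
    obtain ⟨U, V, hUV, -, hUB⟩ := hUV 1 one_pos
    obtain ⟨y, hy, hyc⟩ := TraceMin.not_bddBelow_of_neg_weight hH hB hk hind.1 hUV hUB (hne t) q₀
      hq₀ c
    obtain ⟨X, hX, hXy⟩ := TraceMin.exists_of_frame hQ y hy
    have h1 := hc ⟨X, hX, rfl⟩
    rw [TraceMin.traceObjective_eq_sum hQ hQD] at h1
    simp only [hXy] at h1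
    linarith
  · obtain ⟨y, hy, hye⟩ := TraceMin.exists_eigenvector_frame hA hB hH hk hdiag
    obtain ⟨X, hX, hXy⟩ := TraceMin.exists_of_frame hQ y hy
    exact ⟨X, hX, fun i => by rw [hXy]; exact hye i⟩
  · intro X hX hXe
    rw [TraceMin.traceObjective_eq_sum hQ hQD, ← Finset.sum_neg_distrib]
    refine Finset.sum_congr rfl fun q _ => ?_
    have h1 : TraceMin.sesq B ((X * Q).col q) ((X * Q).col q) = -1 := by
      have h2 := TraceMin.of_conjTranspose_mul_mul_apply B (fun q => (X * Q).col q) q q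
      rw [← h2]
      change ((X * Q)ᴴ * B * (X * Q)) q q = -1
      rw [TraceMin.sesq_col_of_constraint hQ hX]
      simp
    have h3 : TraceMin.sesq A ((X * Q).col q) ((X * Q).col q) =
        (TraceMin.lambdaMinus A hB (q + 1) : ℂ) * TraceMin.sesq B ((X * Q).col q) ((X * Q).col q) := by
      rw [TraceMin.sesq, (hXe q).2.2.2, dotProduct_smul, smul_eq_mul, TraceMin.sesq]
    rw [h3, h1]
    simp
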